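/- **Theorem 4.3 (Carleson–Nikolskii measures).** Let $\mathbb T^2$ carry normalised Lebesgue measure. For a complex Hilbert space $E$ let $H^2(\mathbb T^2;E)$ (resp. $H^2_x(E)$, $H^2_y(E)$) be the space of $f\in L^2(\mathbb T^2;E)$ whose Fourier coefficients $\hat f(m,n)$ vanish whenever $m<0$ or $n<0$ (resp. whenever $m<0$; whenever $n<0$). Let $P_x,P_y$ be the orthogonal projectors of $L^2(\mathbb T^2;E)$ onto $H^2_x(E)$, $H^2_y(E)$, and write $H^2(\mathbb T^2)^\perp(E):=L^2(\mathbb T^2;E)\ominus H^2(\mathbb T^2;E)$. For $E=\mathbb C$ we omit $E$, and $P$ is the orthogonal projector of $L^2(\mathbb T^2)$ onto $H^2(\mathbb T^2)$. A function $\phi\in L^2(\mathbb T^2;E)$ is in $\mathrm{BMO}_r(\mathbb T^2;E)$ if there are $\varphi_0,\varphi_1,\varphi_2\in L^\infty(\mathbb T^2;E)$ with $(I-P_x)\phi=(I-P_x)\varphi_1$, $(I-P_y)\phi=(I-P_y)\varphi_2$ and $P_xP_y\phi=P_xP_y\varphi_0$; $\|\phi\|_{\mathrm{BMO}_r}$ is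 the infimum of $\max_{0\le j\le 2}\|\varphi_j\|_\infty$ over all such triples. For $z\in\mathbb D$ let $b_z(w)=\frac{|z|}{z}\,\frac{z-w}{1-w\bar z}$ if $z\neq 0$, and $b_0(w)=w$. For $(z,\zeta)\in\mathbb D^2$ let $P_{z\zeta}$ be the orthogonal projector onto $K_{z\zeta}=H^2(\mathbb T^2)\ominus (b_z\otimes b_\zeta)H^2(\mathbb T^2)$, and for $\varphi\in L^\infty(\mathbb T^2)$ let $\Gamma_\varphi f=(I-P)(\varphi f)$ for $f\in H^2(\mathbb T^2)$. Let $\mu\ge 0$ be a Borel measure on $\mathbb D^2$ and $d\nu(z,\zeta)=(1-|z|^2)^{-1}(1-|\zeta|^2)^{-1}\,d\mu(z,\zeta)$. For $C\ge 0$, $\mu$ is *Carleson–Nikolskii with constant $C$* if $$\iint_{\mathbb D^2}\|P_{z\zeta}f\|_2^2\,d\nu(z,\zeta)\le C^2\|f\|_2^2\qquad\text{for all } f\in H^2(\mathbb T^2).$$ For $f\in H^2(\mathbb T^2)$, let $\vec\Gamma f$ be the element of $L^2(\mathbb T^2;L^2(\mathbb D^2,\nu))$ (if it exists) that corresponds,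 on exchanging the variables of $\mathbb T^2$ and $\mathbb D^2$, to the function $(z,\zeta)\mapsto\Gamma_{\bar b_z\otimes\bar b_\zeta}f$; that is, for every $(m,n)\in\mathbb Z^2$ its $(m,n)$-th Fourier coefficient is, $\nu$-almost everywhere, the function $(z,\zeta)\mapsto(\Gamma_{\bar b_z\otimes\bar b_\zeta}f)^\wedge(m,n)$. We call $\vec\Gamma$ bounded if it is defined on all of $H^2(\mathbb T^2)$ and is a bounded linear operator $H^2(\mathbb T^2)\to H^2(\mathbb T^2)^\perp(L^2(\mathbb D^2,\nu))$. There is an absolute constant $K<\infty$ such that for every such $\mu$: 1. for every $C\ge0$, $\mu$ is Carleson–Nikolskii with constant $C$ if and only if $\vec\Gamma$ is bounded with $\|\vec\Gamma\|\le C$; 2. for every $C\ge0$, $C$ is the least constant with which $\mu$ is Carleson–Nikolskii if and only if $\vec\Gamma$ is bounded with $\|\vec\Gamma\|=C$; 3. $\mu$ is Carleson–Nikolskii with some constant if and only if $\vec\Gamma 1$ exists and belongs to $\mathrm{BMO}_r(\mathbb T^2;L^2(\mathbb D^2,\nu))$; 4. if $C$ is the least constant with which $\mu$ is Carleson–Nikolskii,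 then $\|\vec\Gamma1\|_{\mathrm{BMO}_r}\le K\,C$ and $C\le K\,\|\vec\Gamma1\|_{\mathrm{BMO}_r}$. -/

import Mathlib

open MeasureTheory
open scoped ENNReal NNReal ComplexConjugate InnerProductSpace

noncomputable section

namespace CarlesonNikolskii

/-- The two-torus `𝕋²`, written additively as `(ℝ/ℤ)²`; the point with coordinates `x 0`, `x 1`
stands for `(exp (2πi x₀), exp (2πi x₁))`. -/
abbrev Torus : Type := UnitAddTorus (Fin 2)

/-- Normalised Haar (Lebesgue) measure on the two-torus. -/
abbrev haarT : Measure Torus := Measure.pi fun _ => AddCircle.haarAddCircle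

/-- The open unit disc `𝔻`, with its Borel σ-algebra. -/
abbrev Disc : Type := Metric.ball (0 : ℂ) 1

/-- `L²(𝕋²; E)`. -/
abbrev L2 (E : Type*) [NormedAddCommGroup E] : Type _ := Lp E 2 haarT

/-- `L^∞(𝕋²; E)`. -/
abbrev Linfty (E : Type*) [NormedAddCommGroup E] : Type _ := Lp E ∞ haarT

section Spaces

variable (E : Type*) [NormedAddCommGroup E] [InnerProductSpace ℂ E] [CompleteSpace E]

/-- The `n`-th Fourier coefficient, as a continuous linear map on `L²(𝕋²; E)`. -/
theorem exists_coeffCLM (n : Fin 2 → ℤ) :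
    ∃ T : L2 E →L[ℂ] E, ∀ f : L2 E, T f = UnitAddTorus.mFourierCoeff f n := by
  refine ⟨(ContinuousLinearMap.lsmul ℂ ℂ).lpPairing haarT 2 2
    (UnitAddTorus.mFourierLp 2 (-n)), fun f => ?_⟩
  rw [ContinuousLinearMap.lpPairing_eq_integral]
  refine integral_congr_ae ?_
  filter_upwards [UnitAddTorus.coeFn_mFourierLp 2 (-n)] with t ht
  rw [ContinuousLinearMap.lsmul_apply]
  exact congrArg (· • f t) ht

/-- The subspace of `L²(𝕋²; E)` of the functions whose Fourier coefficients vanish off `s`. -/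
def spectralSubspace (s : Set (Fin 2 → ℤ)) : Submodule ℂ (L2 E) where
  carrier := {f | ∀ n, n ∉ s → UnitAddTorus.mFourierCoeff f n = 0}
  zero_mem' := by
    intro n _
    obtain ⟨T, hT⟩ := exists_coeffCLM E n
    rw [← hT, map_zero]
  add_mem' := by
    intro f g hf hg n hn
    obtain ⟨T, hT⟩ := exists_coeffCLM E n
    rw [← hT, map_add, hT, hT, hf n hn, hg n hn, add_zero]
  smul_mem' := by
    intro c f hf n hn
    obtain ⟨T, hT⟩ := exists_coeffCLM E n
    rw [← hT, map_smul, hT, hf n hn, smul_zero]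

theorem isClosed_spectralSubspace (s : Set (Fin 2 → ℤ)) :
    IsClosed (spectralSubspace E s : Set (L2 E)) := by
  have h : (spectralSubspace E s : Set (L2 E)) =
      ⋂ n, ⋂ (_ : n ∉ s), {f : L2 E | UnitAddTorus.mFourierCoeff f n = 0} := by
    ext f
    simp [spectralSubspace]
  rw [h]
  refine isClosed_iInter fun n => isClosed_iInter fun _ => ?_
  obtain ⟨T, hT⟩ := exists_coeffCLM E n
  simp only [← hT]
  exact isClosed_eq T.continuous continuous_const

instance completeSpace_spectralSubspace (s : Set (Fin 2 → ℤ)) :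
    CompleteSpace (spectralSubspace E s) :=
  (isClosed_spectralSubspace E s).completeSpace_coe

/-- The Hardy space `H²(𝕋²; E)`: Fourier coefficients vanish when some `n k < 0`. -/
abbrev hardy : Submodule ℂ (L2 E) := spectralSubspace E {n | ∀ k, 0 ≤ n k}

/-- The space `H²_{x_k}`: Fourier coefficients vanish when `n k < 0`. -/
abbrev hardyVar (k : Fin 2) : Submodule ℂ (L2 E) := spectralSubspace E {n | 0 ≤ n k}

/-- The analytic projector `P_{x_k}` in the `k`-th variable. -/
def projVar (k : Fin 2) : L2 E →L[ℂ] L2 E := (hardyVar E k).starProjection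

variable {E}

/-- The inclusion of `L^∞(𝕋²; E)` in `L²(𝕋²; E)`. -/
def toL2 (φ : Linfty E) : L2 E := ((Lp.memLp φ).mono_exponent le_top).toLp φ

/-- The bounded functions `φ₀`, `φ₁`, `φ₂` exhibit `φ` as an element of `BMO_r(𝕋²; E)`. -/
structure IsBMOrDecomposition (φ : L2 E) (φ₀ φ₁ φ₂ : Linfty E) : Prop where
  first : φ - projVar E 0 φ = toL2 φ₁ - projVar E 0 (toL2 φ₁)
  second : φ - projVar E 1 φ = toL2 φ₂ - projVar E 1 (toL2 φ₂)
  both : projVar E 0 (projVar E 1 φ) = projVar E 0 (projVar E 1 (toL2 φ₀))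

/-- Membership in restricted BMO, `BMO_r(𝕋²; E)`. -/
def MemBMOr (φ : L2 E) : Prop := ∃ φ₀ φ₁ φ₂ : Linfty E, IsBMOrDecomposition φ φ₀ φ₁ φ₂

/-- The norm of `BMO_r(𝕋²; E)` (infinite exactly off that space): the infimum of
`max ‖φ_j‖_∞` over all decompositions. -/
def bmorNorm (φ : L2 E) : ℝ≥0∞ :=
  ⨅ (φ₀ : Linfty E) (φ₁ : Linfty E) (φ₂ : Linfty E) (_ : IsBMOrDecomposition φ φ₀ φ₁ φ₂),
    max ‖φ₀‖ₑ (max ‖φ₁‖ₑ ‖φ₂‖ₑ)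

end Spaces

section Scalar

/-- Multiplication by the bounded function `φ` on `L²(𝕋²)`. -/
def mulOp (φ : Linfty ℂ) : L2 ℂ →L[ℂ] L2 ℂ :=
  (ContinuousLinearMap.mul ℂ ℂ).holderL haarT ∞ 2 2 φ

/-- The big Hankel operator `Γ_φ f = (I - P)(φ f)` from `H²(𝕋²)` to `H²(𝕋²)^⊥`, where `I - P` is
the orthogonal projector onto `H²(𝕋²)^⊥`. -/
def hankel (φ : Linfty ℂ) : hardy ℂ →L[ℂ] (hardy ℂ)ᗮ :=
  (hardy ℂ)ᗮ.orthogonalProjectionOnto ∘L mulOp φ ∘L (hardy ℂ).subtypeL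

/-- The constant function `1`, as an element of `H²(𝕋²)`. -/
def oneH2 : hardy ℂ :=
  ⟨UnitAddTorus.mFourierLp 2 0, by
    intro n hn
    have h0 : (0 : Fin 2 → ℤ) ≠ n := by
      rintro rfl
      exact hn fun k => le_rfl
    rw [← UnitAddTorus.mFourierBasis_repr, HilbertBasis.repr_apply_apply,
      UnitAddTorus.coe_mFourierBasis]
    exact UnitAddTorus.orthonormal_mFourier.2 h0.symm⟩

/-- The Blaschke factor `b_z(w) = (|z| / z) (z - w) / (1 - w z̄)`, with `b_0(w) = w`. -/
def blaschke (z w : ℂ) : ℂ :=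
  if z = 0 then w else (‖z‖ / z) * ((z - w) / (1 - w * conj z))

theorem continuous_blaschke (z : Disc) :
    Continuous fun t : UnitAddCircle => blaschke z (fourier 1 t) := by
  unfold blaschke
  split_ifs with h
  · fun_prop
  · refine continuous_const.mul (Continuous.div (by fun_prop) (by fun_prop) fun t ht => ?_)
    have hz : ‖(z : ℂ)‖ < 1 := mem_ball_zero_iff.mp z.2
    have h1 : ‖(fourier 1 t : ℂ) * conj (z : ℂ)‖ = 1 := by
      rw [← sub_eq_zero.mp ht, norm_one]
    rw [norm_mul, fourier_apply, Circle.norm_coe, one_mul, RCLike.norm_conj] at h1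
    exact hz.ne h1

/-- The function `b_z ⊗ b_ζ` on the two-torus, for `p = (z, ζ)` in the bidisc. -/
def blaschkeTensor (p : Disc × Disc) : C(Torus, ℂ) where
  toFun x := blaschke p.1 (fourier 1 (x 0)) * blaschke p.2 (fourier 1 (x 1))
  continuous_toFun :=
    ((continuous_blaschke p.1).comp (continuous_apply 0)).mul
      ((continuous_blaschke p.2).comp (continuous_apply 1))

/-- `b_z ⊗ b_ζ` as an element of `L^∞(𝕋²)`. -/
def symb (p : Disc × Disc) : Linfty ℂ := (blaschkeTensor p).toLp ∞ haarT ℂ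

/-- `b̄_z ⊗ b̄_ζ` as an element of `L^∞(𝕋²)`. -/
def symbConj (p : Disc × Disc) : Linfty ℂ := (star (blaschkeTensor p)).toLp ∞ haarT ℂ

/-- The model space `K_{zζ} = H²(𝕋²) ⊖ (b_z ⊗ b_ζ) H²(𝕋²)`. -/
def modelSpace (p : Disc × Disc) : Submodule ℂ (L2 ℂ) :=
  hardy ℂ ⊓ ((hardy ℂ).map (mulOp (symb p)).toLinearMap)ᗮ

instance completeSpace_modelSpace (p : Disc × Disc) : CompleteSpace (modelSpace p) :=
  ((isClosed_spectralSubspace ℂ _).inter (Submodule.isClosed_orthogonal _)).completeSpace_coe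

/-- The orthogonal projector `P_{zζ}` onto `K_{zζ}`. -/
def projModel (p : Disc × Disc) : L2 ℂ →L[ℂ] L2 ℂ := (modelSpace p).starProjection

end Scalar

section Measures

variable (μ : Measure (Disc × Disc))

/-- The measure `dν = (1 - |z|²)⁻¹ (1 - |ζ|²)⁻¹ dμ`. -/
def nu : Measure (Disc × Disc) :=
  μ.withDensity fun p =>
    ENNReal.ofReal ((1 - ‖(p.1 : ℂ)‖ ^ 2)⁻¹ * (1 - ‖(p.2 : ℂ)‖ ^ 2)⁻¹)

/-- `μ` is a Carleson–Nikolskii measure with constant `C`. -/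
def IsCarlesonNikolskii (C : ℝ≥0) : Prop :=
  ∀ f ∈ hardy ℂ, ∫⁻ p, ‖projModel p f‖ₑ ^ 2 ∂(nu μ) ≤ (C : ℝ≥0∞) ^ 2 * ‖f‖ₑ ^ 2

/-- The Hilbert space `L²(𝔻², ν)`. -/
abbrev L2nu : Type := Lp ℂ 2 (nu μ)

/-- `G ∈ L²(𝕋²; L²(𝔻², ν))` is the value `Γ⃗ f`: it is the function that corresponds to
`(z, ζ) ↦ Γ_{b̄_z ⊗ b̄_ζ} f`, with values in `L²(𝕋²)`, when the torus variable and the bidisc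
variable are exchanged. The exchange is expressed through the Fourier coefficients in the torus
variable, which determine an element of `L²(𝕋²; L²(𝔻², ν))`. -/
def IsHankelValue (f : hardy ℂ) (G : L2 (L2nu μ)) : Prop :=
  ∀ n : Fin 2 → ℤ, (UnitAddTorus.mFourierCoeff G n : L2nu μ) =ᵐ[nu μ]
    fun p => UnitAddTorus.mFourierCoeff (hankel (symbConj p) f : L2 ℂ) n

/-- `T` is the canonically associated Hankel operator
`Γ⃗ : H²(𝕋²) → H²(𝕋²)^⊥(L²(𝔻², ν))`, everywhere defined and bounded. -/
def IsAssociatedHankel (T : hardy ℂ →L[ℂ] (hardy (L2nu μ))ᗮ) : Prop :=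
  ∀ f : hardy ℂ, IsHankelValue μ f (T f : L2 (L2nu μ))

end Measures

end CarlesonNikolskii

end

open CarlesonNikolskii

/-!
Let `b = b_z ⊗ b_ζ`. Since `b` is inner, `P_{zζ} f = f - b P (b̄ f) = b (I - P) (b̄ f)` for
`f ∈ H²(𝕋²)`, so that `‖P_{zζ} f‖ = ‖Γ_{b̄} f‖` (`norm_projModel`). By Parseval's identity, summing
over the Fourier coefficients before or after integrating over the bidisc, the Carleson–Nikolskii
integral of `f` is `‖Γ⃗ f‖²` (`IsHankelValue.lintegral_eq`), and `Γ⃗ f` exists as soon as the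
integral is finite. The first two assertions follow, because `Γ⃗ f` is unique and linear in `f`.

On analytic polynomials, `Γ⃗ h = (I - P) (h Γ⃗ 1)` (`isHankelValue_trigPoly`): `Γ⃗` is a big Hankel
operator with symbol `G = Γ⃗ 1`. If `G` has a decomposition `φ₀, φ₁, φ₂`, then
`I - P = (I - P_x) + P_x (I - P_y)` bounds it by `‖φ₁‖ + ‖φ₂‖`, and Fatou's lemma passes from
polynomials to `H²(𝕋²)`.

Conversely, let `Γ⃗` be bounded by `C`. As `I - P_x` commutes with multiplication by monomials in
`y`, the map `h ↦ (I - P_x) (h G)` is bounded by `C` on all polynomials `h` with frequencies in the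
half-plane `0 ≤ m` (`norm_coProj_halfPlane_contMul_le`). A vector-valued theorem of Nehari type
(`exists_bounded_symbol`) then yields `φ₁` with `‖φ₁‖ ≤ C` and `(I - P_x) G = (I - P_x) φ₁`;
likewise for `y`, and `φ₀ = 0` since `G` is orthogonal to `H²(𝕋²; E)`.

For the Nehari theorem one shows `|⟪G, g⟫| ≤ C ‖g‖₁` for continuous `g` with spectrum outside the
half-plane, extends the functional by Hahn–Banach, and represents it by a bounded function. The
estimate uses a factorization that is elementary in this setting: the real continuous function
`log (‖g‖ + ε)` is uniformly within `ε` of the real part of a polynomial `r` with frequencies in the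
half-plane, and `a = exp (r / 2)` is an invertible element of the analytic algebra with
`|a|² ≈ ‖g‖ + ε`, so that `⟪G, g⟫ = ⟪(I - P_x) (a G), ā⁻¹ g⟫ ≤ C ‖a‖₂ ‖a⁻¹ g‖₂`.
-/

noncomputable section

namespace CarlesonNikolskii

/-! ### Fourier coefficients of Hilbert-space valued functions -/

section Fourier

variable {E : Type*} [NormedAddCommGroup E] [InnerProductSpace ℂ E]

/-- Multiplication of `G ∈ L²(𝕋²; E)` by a continuous scalar function. -/
def contMul : C(Torus, ℂ) →L[ℂ] L2 E →L[ℂ] L2 E :=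
  (ContinuousLinearMap.lsmul ℂ ℂ).holderL haarT ∞ 2 2 ∘L ContinuousMap.toLp ∞ haarT ℂ

theorem coeFn_contMul (h : C(Torus, ℂ)) (G : L2 E) :
    contMul h G =ᵐ[haarT] fun t => h t • G t := by
  have h1 := (ContinuousLinearMap.lsmul ℂ ℂ : ℂ →L[ℂ] E →L[ℂ] E).coeFn_holder (r := 2)
    (ContinuousMap.toLp ∞ haarT ℂ h) G
  refine Filter.EventuallyEq.trans h1 ?_
  filter_upwards [ContinuousMap.coeFn_toLp (p := ∞) (𝕜 := ℂ) haarT h] with t ht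
  rw [ht, ContinuousLinearMap.lsmul_apply]

theorem contMul_mul (h k : C(Torus, ℂ)) (G : L2 E) :
    contMul (h * k) G = contMul h (contMul k G) := by
  refine Lp.ext ?_
  filter_upwards [coeFn_contMul (h * k) G, coeFn_contMul h (contMul k G), coeFn_contMul k G]
    with t h1 h2 h3
  rw [h1, h2, h3, ContinuousMap.mul_apply, mul_smul]

theorem contMul_one (G : L2 E) : contMul 1 G = G := by
  refine Lp.ext ?_
  filter_upwards [coeFn_contMul 1 G] with t h1
  rw [h1, ContinuousMap.one_apply, one_smul]

theorem inner_contMul_left (h : C(Torus, ℂ)) (F G : L2 E) :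
    ⟪contMul h F, G⟫_ℂ = ⟪F, contMul (star h) G⟫_ℂ := by
  rw [L2.inner_def, L2.inner_def]
  refine integral_congr_ae ?_
  filter_upwards [coeFn_contMul h F, coeFn_contMul (star h) G] with t h1 h2
  rw [h1, h2, inner_smul_left, inner_smul_right, ContinuousMap.star_apply, RCLike.star_def]

/-- Multiplication by a unimodular continuous function is isometric. -/
theorem norm_contMul_of_unimodular {h : C(Torus, ℂ)} (hh : ∀ t, ‖h t‖ = 1) (G : L2 E) :
    ‖contMul h G‖ = ‖G‖ := by
  rw [Lp.norm_def, Lp.norm_def]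
  congr 1
  refine eLpNorm_congr_norm_ae ?_
  filter_upwards [coeFn_contMul h G] with t h1
  rw [h1, norm_smul, hh, one_mul]

theorem mFourier_mul_mFourier (m n : Fin 2 → ℤ) :
    (UnitAddTorus.mFourier m * UnitAddTorus.mFourier n : C(Torus, ℂ)) =
      UnitAddTorus.mFourier (m + n) := by
  ext t
  rw [ContinuousMap.mul_apply, UnitAddTorus.mFourier_add]

theorem star_mFourier (n : Fin 2 → ℤ) :
    (star (UnitAddTorus.mFourier n) : C(Torus, ℂ)) = UnitAddTorus.mFourier (-n) := by
  ext t
  rw [ContinuousMap.star_apply, UnitAddTorus.mFourier_neg, RCLike.star_def]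

theorem norm_mFourier_apply (n : Fin 2 → ℤ) (t : Torus) : ‖UnitAddTorus.mFourier n t‖ = 1 := by
  simp only [UnitAddTorus.mFourier, ContinuousMap.coe_mk, norm_prod, fourier_apply,
    Circle.norm_coe, Finset.prod_const_one]

theorem mFourierCoeff_eq (G : Torus → E) (n : Fin 2 → ℤ) :
    UnitAddTorus.mFourierCoeff G n = ∫ t, UnitAddTorus.mFourier (-n) t • G t ∂haarT := rfl

theorem mFourierCoeff_contMul_mFourier (k n : Fin 2 → ℤ) (G : L2 E) :
    UnitAddTorus.mFourierCoeff (contMul (UnitAddTorus.mFourier k) G) n =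
      UnitAddTorus.mFourierCoeff G (n - k) := by
  refine integral_congr_ae ?_
  filter_upwards [coeFn_contMul (UnitAddTorus.mFourier k) G] with t ht
  rw [ht, smul_smul, ← UnitAddTorus.mFourier_add]
  congr 3
  abel

/-- The constant function `v`. -/
def constL2 : E →L[ℂ] L2 E := Lp.constL 2 haarT ℂ

theorem coeFn_constL2 (v : E) : constL2 v =ᵐ[haarT] fun _ => v := Lp.coeFn_const 2 haarT v

/-- The isometric embedding `v ↦ e_n ⊗ v` of `E` into `L²(𝕋²; E)`. -/
def monomial (n : Fin 2 → ℤ) : E →ₗᵢ[ℂ] L2 E where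
  toLinearMap := (contMul (UnitAddTorus.mFourier n) ∘L constL2).toLinearMap
  norm_map' v := by
    change ‖contMul (UnitAddTorus.mFourier n) (constL2 v)‖ = ‖v‖
    rw [norm_contMul_of_unimodular (norm_mFourier_apply n)]
    change ‖Lp.const 2 haarT v‖ = ‖v‖
    simp [Lp.norm_const' (p := 2) (μ := haarT)]

theorem monomial_apply (n : Fin 2 → ℤ) (v : E) :
    monomial n v = contMul (UnitAddTorus.mFourier n) (constL2 v) := rfl

theorem integrable_mFourier_smul (n : Fin 2 → ℤ) (G : L2 E) :
    Integrable (fun t => UnitAddTorus.mFourier n t • G t) haarT := by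
  have h1 : Integrable (contMul (UnitAddTorus.mFourier n) G) haarT :=
    (Lp.memLp _).integrable (by norm_num)
  exact h1.congr (coeFn_contMul _ G)

variable [CompleteSpace E]

theorem inner_monomial (n : Fin 2 → ℤ) (v : E) (G : L2 E) :
    ⟪monomial n v, G⟫_ℂ = ⟪v, UnitAddTorus.mFourierCoeff G n⟫_ℂ := by
  rw [monomial_apply, inner_contMul_left, star_mFourier, L2.inner_def, mFourierCoeff_eq,
    ← integral_inner (integrable_mFourier_smul _ G)]
  refine integral_congr_ae ?_
  filter_upwards [coeFn_constL2 v, coeFn_contMul (UnitAddTorus.mFourier (-n)) G] with t h1 h2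
  rw [h1, h2]

theorem mFourierCoeff_const (v : E) (n : Fin 2 → ℤ) :
    UnitAddTorus.mFourierCoeff (constL2 v) n = if n = 0 then v else 0 := by
  have h1 : UnitAddTorus.mFourierCoeff (constL2 v) n =
      (∫ t, UnitAddTorus.mFourier (-n) t ∂haarT : ℂ) • v := by
    rw [← integral_smul_const, mFourierCoeff_eq]
    refine integral_congr_ae ?_
    filter_upwards [coeFn_constL2 v] with t ht
    rw [ht]
  have h2 : (∫ t, UnitAddTorus.mFourier (-n) t ∂haarT : ℂ) = if n = 0 then 1 else 0 := by
    have := (orthonormal_iff_ite.mp (UnitAddTorus.orthonormal_mFourier (d := Fin 2))) n 0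
    rw [ContinuousMap.inner_toLp] at this
    rw [← this]
    refine integral_congr_ae (Filter.Eventually.of_forall fun t => ?_)
    simp [UnitAddTorus.mFourier_zero, UnitAddTorus.mFourier_neg]
  rw [h1, h2]
  split_ifs <;> simp

theorem mFourierCoeff_monomial (m n : Fin 2 → ℤ) (v : E) :
    UnitAddTorus.mFourierCoeff (monomial m v) n = if n = m then v else 0 := by
  rw [monomial_apply, mFourierCoeff_contMul_mFourier, mFourierCoeff_const]
  simp [sub_eq_zero]

theorem inner_mFourierCoeff (G : L2 E) (v : E) (n : Fin 2 → ℤ) :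
    UnitAddTorus.mFourierCoeff ((innerSL ℂ v).compLp G) n =
      ⟪v, UnitAddTorus.mFourierCoeff G n⟫_ℂ := by
  rw [mFourierCoeff_eq, mFourierCoeff_eq, ← integral_inner (integrable_mFourier_smul _ G)]
  refine integral_congr_ae ?_
  filter_upwards [ContinuousLinearMap.coeFn_compLp (innerSL ℂ v) G] with t ht
  rw [ht, inner_smul_right, innerSL_apply_apply, smul_eq_mul]

/-- An element of `L²(𝕋²; E)` all of whose Fourier coefficients vanish is zero. This reduces to the
scalar case by testing against the functionals `⟪v, ·⟫`, as `G` is essentially separably valued. -/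
theorem eq_zero_of_mFourierCoeff_eq_zero {G : L2 E}
    (hG : ∀ n, UnitAddTorus.mFourierCoeff G n = 0) : G = 0 := by
  obtain ⟨t, ht, ht'⟩ := (Lp.aestronglyMeasurable G).isSeparable_ae_range
  refine (Lp.eq_zero_iff_ae_eq_zero).2
    (ae_eq_zero_of_forall_dual_of_isSeparable ℂ ht (fun c => ?_) ht')
  obtain ⟨v, rfl⟩ := (InnerProductSpace.toDual ℂ E).surjective c
  have h0 : (innerSL ℂ v).compLp G = 0 := by
    refine (UnitAddTorus.mFourierBasis (d := Fin 2)).repr.injective ?_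
    ext n
    rw [UnitAddTorus.mFourierBasis_repr]
    erw [inner_mFourierCoeff, hG, inner_zero_right]
    simp
  have h1 := ContinuousLinearMap.coeFn_compLp (innerSL ℂ v) G
  rw [h0] at h1
  filter_upwards [h1, Lp.coeFn_zero ℂ 2 haarT] with x h2 h3
  rw [h3] at h2
  exact h2.symm

theorem isHilbertSum_monomial :
    IsHilbertSum ℂ (fun _ : Fin 2 → ℤ => E) (fun n => (monomial n : E →ₗᵢ[ℂ] L2 E)) := by
  refine IsHilbertSum.mk (fun m n hmn v w => ?_) ?_
  · rw [inner_monomial, mFourierCoeff_monomial, if_neg hmn, inner_zero_right]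
  · rw [top_le_iff, Submodule.topologicalClosure_eq_top_iff, eq_bot_iff]
    intro G hG
    refine eq_zero_of_mFourierCoeff_eq_zero fun n => ?_
    refine ext_inner_left ℂ fun v => ?_
    rw [← inner_monomial, inner_zero_right]
    exact hG _ (Submodule.mem_iSup_of_mem n ⟨v, rfl⟩)

/-- The Fourier transform as a unitary operator of `L²(𝕋²; E)` onto `ℓ²(ℤ²; E)`. -/
def fourierIso : L2 E ≃ₗᵢ[ℂ] lp (fun _ : Fin 2 → ℤ => E) 2 :=
  isHilbertSum_monomial.linearIsometryEquiv

theorem fourierIso_apply (G : L2 E) (n : Fin 2 → ℤ) :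
    fourierIso G n = UnitAddTorus.mFourierCoeff G n := by
  classical
  refine ext_inner_left ℂ fun v => ?_
  have h1 := lp.inner_single_left (𝕜 := ℂ) (G := fun _ : Fin 2 → ℤ => E) n v (fourierIso G)
  rw [← fourierIso.symm.inner_map_map, LinearIsometryEquiv.symm_apply_apply] at h1
  have h2 : fourierIso.symm (lp.single 2 n v) = monomial n v :=
    isHilbertSum_monomial.linearIsometryEquiv_symm_apply_single v
  rw [h2, inner_monomial] at h1
  exact h1.symm

theorem ext_mFourierCoeff {F G : L2 E}
    (h : ∀ n, UnitAddTorus.mFourierCoeff F n = UnitAddTorus.mFourierCoeff G n) : F = G := by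
  refine fourierIso.injective ?_
  ext n
  rw [fourierIso_apply, fourierIso_apply, h]

variable (E) in
/-- The `n`-th Fourier coefficient as a continuous linear map. -/
def coeffCLM (n : Fin 2 → ℤ) : L2 E →L[ℂ] E := (exists_coeffCLM E n).choose

theorem coeffCLM_apply (n : Fin 2 → ℤ) (G : L2 E) :
    coeffCLM E n G = UnitAddTorus.mFourierCoeff G n := (exists_coeffCLM E n).choose_spec G

theorem mFourierCoeff_add (F G : L2 E) (n : Fin 2 → ℤ) :
    UnitAddTorus.mFourierCoeff (F + G : L2 E) n =
      UnitAddTorus.mFourierCoeff F n + UnitAddTorus.mFourierCoeff G n := by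
  simp only [← coeffCLM_apply, map_add]

theorem mFourierCoeff_sub (F G : L2 E) (n : Fin 2 → ℤ) :
    UnitAddTorus.mFourierCoeff (F - G : L2 E) n =
      UnitAddTorus.mFourierCoeff F n - UnitAddTorus.mFourierCoeff G n := by
  simp only [← coeffCLM_apply, map_sub]

theorem mFourierCoeff_smul (c : ℂ) (G : L2 E) (n : Fin 2 → ℤ) :
    UnitAddTorus.mFourierCoeff (c • G : L2 E) n = c • UnitAddTorus.mFourierCoeff G n := by
  simp only [← coeffCLM_apply, map_smul]

theorem mFourierCoeff_zero (n : Fin 2 → ℤ) :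
    UnitAddTorus.mFourierCoeff (0 : L2 E) n = 0 := by
  simp only [← coeffCLM_apply, map_zero]

/-- Parseval's identity for `E`-valued functions. -/
theorem enorm_sq_eq_tsum (G : L2 E) :
    ‖G‖ₑ ^ 2 = ∑' n : Fin 2 → ℤ, ‖UnitAddTorus.mFourierCoeff G n‖ₑ ^ 2 := by
  have h1 : ‖G‖ ^ 2 = ∑' n : Fin 2 → ℤ, ‖UnitAddTorus.mFourierCoeff G n‖ ^ 2 := by
    have := lp.norm_rpow_eq_tsum (p := 2) (by norm_num) (fourierIso G)
    simpa [fourierIso_apply] using this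
  have h2 : Summable fun n : Fin 2 → ℤ => ‖UnitAddTorus.mFourierCoeff G n‖ ^ 2 := by
    have := (lp.memℓp (fourierIso G)).summable (by norm_num)
    simpa [fourierIso_apply] using this
  have h3 := ENNReal.ofReal_tsum_of_nonneg (fun n => sq_nonneg ‖UnitAddTorus.mFourierCoeff G n‖) h2
  rw [← h1, ENNReal.ofReal_pow (norm_nonneg _), ofReal_norm] at h3
  rw [h3]
  refine tsum_congr fun n => ?_
  rw [ENNReal.ofReal_pow (norm_nonneg _), ofReal_norm]

/-- Every square-summable family is the family of Fourier coefficients of some function. -/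
theorem exists_mFourierCoeff_eq (c : (Fin 2 → ℤ) → E) (hc : ∑' n, ‖c n‖ₑ ^ 2 ≠ ∞) :
    ∃ G : L2 E, ∀ n, UnitAddTorus.mFourierCoeff G n = c n := by
  have h : Memℓp c 2 := by
    refine memℓp_gen ?_
    have h1 := ENNReal.summable_toReal hc
    refine h1.congr fun n => ?_
    simp
  refine ⟨fourierIso.symm ⟨c, h⟩, fun n => ?_⟩
  rw [← fourierIso_apply, LinearIsometryEquiv.apply_symm_apply]

theorem inner_eq_zero_of_spectral {s : Set (Fin 2 → ℤ)} {F G : L2 E}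
    (hF : F ∈ spectralSubspace E s) (hG : G ∈ spectralSubspace E sᶜ) : ⟪F, G⟫_ℂ = 0 := by
  rw [← fourierIso.inner_map_map, lp.inner_eq_tsum]
  refine (tsum_congr fun n => ?_).trans tsum_zero
  rw [fourierIso_apply, fourierIso_apply]
  by_cases hn : n ∈ s
  · rw [hG n (fun h => h hn), inner_zero_right]
  · rw [hF n hn, inner_zero_left]

open Classical in
theorem mFourierCoeff_starProjection (s : Set (Fin 2 → ℤ)) (G : L2 E) (n : Fin 2 → ℤ) :
    UnitAddTorus.mFourierCoeff ((spectralSubspace E s).starProjection G) n =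
      if n ∈ s then UnitAddTorus.mFourierCoeff G n else 0 := by
  obtain ⟨F, hF⟩ := exists_mFourierCoeff_eq
    (fun n => if n ∈ s then UnitAddTorus.mFourierCoeff G n else 0) (by
      refine ne_top_of_le_ne_top ?_ (ENNReal.tsum_le_tsum
        (g := fun n => ‖UnitAddTorus.mFourierCoeff G n‖ₑ ^ 2) fun n => ?_)
      · rw [← enorm_sq_eq_tsum]; finiteness
      · split_ifs <;> simp)
  have h1 : (spectralSubspace E s).starProjection G = F := by
    refine Submodule.eq_starProjection_of_mem_of_inner_eq_zero ?_ fun w hw => ?_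
    · intro n hn
      rw [hF, if_neg hn]
    · rw [← inner_conj_symm, inner_eq_zero_of_spectral hw, map_zero]
      intro n hn
      rw [mFourierCoeff_sub, hF, if_pos (by simpa using hn), sub_self]
  rw [h1, hF]

theorem mem_orthogonal_spectralSubspace {s : Set (Fin 2 → ℤ)} {G : L2 E} :
    G ∈ (spectralSubspace E s)ᗮ ↔ ∀ n ∈ s, UnitAddTorus.mFourierCoeff G n = 0 := by
  classical
  rw [← Submodule.starProjection_apply_eq_zero_iff]
  constructor
  · intro h n hn
    have := mFourierCoeff_starProjection s G n
    rw [h, mFourierCoeff_zero, if_pos hn] at this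
    exact this.symm
  · intro h
    refine ext_mFourierCoeff fun n => ?_
    rw [mFourierCoeff_starProjection, mFourierCoeff_zero]
    split_ifs with hn
    · exact h n hn
    · rfl

end Fourier

/-! ### Continuous functions with spectrum in a semigroup -/

section AnalyticAlgebra

/-- The trigonometric polynomials with frequencies in `S`. -/
def trigPoly (S : AddSubmonoid (Fin 2 → ℤ)) : Submodule ℂ C(Torus, ℂ) :=
  Submodule.span ℂ (UnitAddTorus.mFourier '' S)

/-- The uniform closure of the algebra of trigonometric polynomials with frequencies in `S`. -/
def contAlg (S : AddSubmonoid (Fin 2 → ℤ)) : Subalgebra ℂ C(Torus, ℂ) :=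
  (Algebra.adjoin ℂ (UnitAddTorus.mFourier '' S)).topologicalClosure

variable {S : AddSubmonoid (Fin 2 → ℤ)}

theorem mFourier_mem_trigPoly {n : Fin 2 → ℤ} (hn : n ∈ S) :
    UnitAddTorus.mFourier n ∈ trigPoly S := Submodule.subset_span ⟨n, hn, rfl⟩

theorem toSubmodule_adjoin_mFourier :
    Subalgebra.toSubmodule (Algebra.adjoin ℂ (UnitAddTorus.mFourier '' (S : Set (Fin 2 → ℤ)))) =
      trigPoly S := by
  refine Algebra.adjoin_eq_span_of_subset _ fun x hx => Submodule.subset_span ?_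
  refine Submonoid.closure_induction (fun _ => id) ⟨0, S.zero_mem, ?_⟩ ?_ hx
  · exact UnitAddTorus.mFourier_zero
  · rintro _ _ _ _ ⟨m, hm, rfl⟩ ⟨n, hn, rfl⟩
    exact ⟨m + n, S.add_mem hm hn, (mFourier_mul_mFourier m n).symm⟩

theorem trigPoly_le_contAlg {h : C(Torus, ℂ)} (hh : h ∈ trigPoly S) : h ∈ contAlg S := by
  rw [← toSubmodule_adjoin_mFourier] at hh
  exact Subalgebra.le_topologicalClosure _ hh

theorem isClosed_contAlg : IsClosed (contAlg S : Set C(Torus, ℂ)) :=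
  Subalgebra.isClosed_topologicalClosure _

/-- A closed condition that holds for trigonometric polynomials holds on their uniform closure. -/
theorem contAlg_induction {p : C(Torus, ℂ) → Prop} (hp : IsClosed {h | p h})
    (hpoly : ∀ h ∈ trigPoly S, p h) {h : C(Torus, ℂ)} (hh : h ∈ contAlg S) : p h := by
  refine closure_minimal (s := (trigPoly S : Set C(Torus, ℂ))) hpoly hp ?_
  rw [← toSubmodule_adjoin_mFourier]
  exact hh

theorem exp_mem_contAlg {r : C(Torus, ℂ)} (hr : r ∈ contAlg S) :
    NormedSpace.exp r ∈ contAlg S := NormedSpace.exp_mem isClosed_contAlg hr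

theorem exp_continuousMap_apply (r : C(Torus, ℂ)) (t : Torus) :
    NormedSpace.exp r t = Complex.exp (r t) := by
  rw [Complex.exp_eq_exp_ℂ]
  exact NormedSpace.map_exp (ContinuousMap.evalAlgHom ℂ ℂ t) (continuous_eval_const t) r

/-- If every frequency or its opposite lies in `S`, every real continuous function is uniformly
approximated by real parts of trigonometric polynomials with frequencies in `S`. -/
theorem exists_re_trigPoly_near (hS : ∀ n, n ∈ S ∨ -n ∈ S) {u : Torus → ℝ} (hu : Continuous u)
    {ε : ℝ} (hε : 0 < ε) : ∃ r ∈ trigPoly S, ∀ t, |(r t).re - u t| < ε := by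
  have key : ∀ q ∈ Submodule.span ℂ (Set.range (UnitAddTorus.mFourier (d := Fin 2))),
      ∀ c : ℂ, ∃ r ∈ trigPoly S, ∀ t, (r t).re = (c * q t).re := by
    intro q hq
    induction hq using Submodule.span_induction with
    | zero => exact fun c => ⟨0, zero_mem _, fun t => by simp⟩
    | add x y _ _ hx hy =>
      intro c
      obtain ⟨r, hr, hr'⟩ := hx c
      obtain ⟨s, hs, hs'⟩ := hy c
      exact ⟨r + s, add_mem hr hs, fun t => by
        rw [ContinuousMap.add_apply, ContinuousMap.add_apply, Complex.add_re, hr', hs', mul_add,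
          Complex.add_re]⟩
    | smul d x _ hx =>
      intro c
      obtain ⟨r, hr, hr'⟩ := hx (c * d)
      exact ⟨r, hr, fun t => by rw [hr', ContinuousMap.smul_apply, smul_eq_mul, mul_assoc]⟩
    | mem x hx =>
      obtain ⟨n, rfl⟩ := hx
      intro c
      rcases hS n with hn | hn
      · exact ⟨c • UnitAddTorus.mFourier n, Submodule.smul_mem _ c (mFourier_mem_trigPoly hn),
          fun t => by simp⟩
      · -- conjugation does not change the real part and reverses the frequency
        refine ⟨conj c • UnitAddTorus.mFourier (-n),
          Submodule.smul_mem _ _ (mFourier_mem_trigPoly hn), fun t => ?_⟩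
        rw [ContinuousMap.smul_apply, UnitAddTorus.mFourier_neg, smul_eq_mul, ← map_mul,
          Complex.conj_re]
  let U : C(Torus, ℂ) := ⟨fun t => (u t : ℂ), by fun_prop⟩
  have hU : U ∈ (Submodule.span ℂ
      (Set.range (UnitAddTorus.mFourier (d := Fin 2)))).topologicalClosure := by
    rw [UnitAddTorus.span_mFourier_closure_eq_top]; trivial
  obtain ⟨q, hq, hqU⟩ := Metric.mem_closure_iff.1 hU ε hε
  obtain ⟨r, hr, hr'⟩ := key q hq 1
  refine ⟨r, hr, fun t => ?_⟩
  have h1 : (r t).re - u t = (q t - U t).re := by simp [hr', U]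
  rw [h1]
  refine (Complex.abs_re_le_norm _).trans_lt ?_
  rw [← dist_eq_norm, dist_comm]
  exact (ContinuousMap.dist_apply_le_dist t).trans_lt hqU

variable {E : Type*} [NormedAddCommGroup E] [InnerProductSpace ℂ E] [CompleteSpace E]

theorem contMul_mem_spectralSubspace {h : C(Torus, ℂ)} (hh : h ∈ contAlg S) {G : L2 E}
    (hG : G ∈ spectralSubspace E (S : Set (Fin 2 → ℤ))) :
    contMul h G ∈ spectralSubspace E (S : Set (Fin 2 → ℤ)) := by
  refine contAlg_induction (p := fun h => contMul h G ∈ spectralSubspace E (S : Set (Fin 2 → ℤ)))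
    ?_ (fun h hh => ?_) hh
  · exact (isClosed_spectralSubspace E _).preimage (contMul.flip G).continuous
  · induction hh using Submodule.span_induction with
    | zero => rw [map_zero]; exact zero_mem _
    | add x y _ _ hx hy => rw [map_add]; exact add_mem hx hy
    | smul c x _ hx => rw [map_smul]; exact Submodule.smul_mem _ c hx
    | mem x hx =>
      obtain ⟨k, hk, rfl⟩ := hx
      intro n hn
      rw [mFourierCoeff_contMul_mFourier]
      refine hG _ fun h => hn ?_
      have := S.add_mem h hk
      rwa [sub_add_cancel] at this

/-- Conjugates of analytic functions preserve the orthogonal complement, by duality. -/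
theorem contMul_star_mem_orthogonal {h : C(Torus, ℂ)} (hh : h ∈ contAlg S) {G : L2 E}
    (hG : G ∈ (spectralSubspace E (S : Set (Fin 2 → ℤ)))ᗮ) :
    contMul (star h) G ∈ (spectralSubspace E (S : Set (Fin 2 → ℤ)))ᗮ := by
  intro F hF
  rw [← inner_contMul_left]
  exact hG _ (contMul_mem_spectralSubspace hh hF)

end AnalyticAlgebra

/-! ### Hankel operators with respect to a half-plane of frequencies -/

section Nehari

variable {E : Type*} [NormedAddCommGroup E]

theorem integrable_norm_sq (G : L2 E) : Integrable (fun t => ‖G t‖ ^ 2) haarT :=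
  (memLp_two_iff_integrable_sq_norm (Lp.aestronglyMeasurable G)).1 (Lp.memLp G)

theorem integrable_norm (G : L2 E) : Integrable (fun t => ‖G t‖) haarT :=
  ((Lp.memLp G).integrable (by norm_num)).norm

theorem coeFn_toL2 (φ : Linfty E) : toL2 φ =ᵐ[haarT] φ := MemLp.coeFn_toLp _

theorem exists_toL2_eq {φ : L2 E} {C : ℝ} (hC : 0 ≤ C) (h : ∀ᵐ t ∂haarT, ‖φ t‖ ≤ C) :
    ∃ ψ : Linfty E, ‖ψ‖ ≤ C ∧ toL2 ψ = φ := by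
  have hm := memLp_top_of_bound (Lp.aestronglyMeasurable φ) C h
  refine ⟨hm.toLp φ, ?_, ?_⟩
  · refine (Lp.norm_le_of_ae_bound hC ?_).trans_eq (?_ : _ = C)
    · filter_upwards [hm.coeFn_toLp, h] with t h1 h2
      rwa [h1]
    · simp
  · exact Lp.ext ((coeFn_toL2 _).trans hm.coeFn_toLp)

variable [InnerProductSpace ℂ E]

theorem norm_sq_eq_integral (G : L2 E) : ‖G‖ ^ 2 = ∫ t, ‖G t‖ ^ 2 ∂haarT := by
  have h1 : ((‖G‖ ^ 2 : ℝ) : ℂ) = ((∫ t, ‖G t‖ ^ 2 ∂haarT : ℝ) : ℂ) := by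
    rw [← integral_complex_ofReal, Complex.ofReal_pow]
    refine (inner_self_eq_norm_sq_to_K (𝕜 := ℂ) G).symm.trans ?_
    rw [L2.inner_def]
    refine integral_congr_ae (.of_forall fun t => ?_)
    simp only [inner_self_eq_norm_sq_to_K, Complex.ofReal_pow]
    rfl
  exact_mod_cast h1

variable (E) in
/-- The inclusion of `L²(𝕋²; E)` in `L¹(𝕋²; E)`. -/
def toL1 : L2 E →L[ℂ] Lp E 1 haarT :=
  (ContinuousLinearMap.lsmul ℂ ℂ).holderL haarT 2 2 1 (Lp.const 2 haarT (1 : ℂ))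

theorem norm_toL1 (G : L2 E) : ‖toL1 E G‖ = ∫ t, ‖G t‖ ∂haarT := by
  rw [L1.norm_eq_integral_norm]
  refine integral_congr_ae ?_
  filter_upwards [(ContinuousLinearMap.lsmul ℂ ℂ : ℂ →L[ℂ] E →L[ℂ] E).coeFn_holder (r := 1)
    (Lp.const 2 haarT (1 : ℂ)) G, Lp.coeFn_const 2 haarT (1 : ℂ)] with t h1 h2
  change ‖(ContinuousLinearMap.lsmul ℂ ℂ : ℂ →L[ℂ] E →L[ℂ] E).holder 1 _ G t‖ = _
  rw [h1, h2]
  simp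

/-- A function that pairs against `L²` with an `L¹` bound is essentially bounded. -/
theorem ae_norm_le_of_inner_le {φ : L2 E} {C : ℝ} (hC : 0 ≤ C)
    (h : ∀ G : L2 E, ‖⟪φ, G⟫_ℂ‖ ≤ C * ∫ t, ‖G t‖ ∂haarT) : ∀ᵐ t ∂haarT, ‖φ t‖ ≤ C := by
  -- test against the restriction of `φ` to the set where the bound fails
  have hA : MeasurableSet {t | C < ‖φ t‖} :=
    measurableSet_lt measurable_const (Lp.stronglyMeasurable φ).norm.measurable
  set A := {t | C < ‖φ t‖}
  let G : L2 E := ((Lp.memLp φ).indicator hA).toLp (A.indicator φ)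
  have hG : G =ᵐ[haarT] A.indicator φ := MemLp.coeFn_toLp _
  have h1 : ⟪φ, G⟫_ℂ = ((∫ t in A, ‖φ t‖ ^ 2 ∂haarT : ℝ) : ℂ) := by
    rw [L2.inner_def, ← integral_complex_ofReal, ← integral_indicator hA]
    refine integral_congr_ae ?_
    filter_upwards [hG] with t ht
    rw [ht]
    by_cases htA : t ∈ A
    · simp [htA, inner_self_eq_norm_sq_to_K]
    · simp [htA]
  have h2 : ∫ t, ‖G t‖ ∂haarT = ∫ t in A, ‖φ t‖ ∂haarT := by
    rw [← integral_indicator hA]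
    refine integral_congr_ae ?_
    filter_upwards [hG] with t ht
    rw [ht, Set.indicator_apply, Set.indicator_apply]
    split_ifs <;> simp
  have h3 := h G
  rw [h1, h2, Complex.norm_real, Real.norm_of_nonneg (by positivity), ← integral_const_mul] at h3
  have hi1 := (integrable_norm_sq φ).integrableOn (s := A)
  have hi2 := ((integrable_norm φ).const_mul C).integrableOn (s := A)
  have h4 : ∫ t in A, (‖φ t‖ ^ 2 - C * ‖φ t‖) ∂haarT = 0 := by
    refine le_antisymm ?_ (setIntegral_nonneg hA fun t (ht : C < ‖φ t‖) => ?_)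
    · rw [integral_sub hi1 hi2]; linarith
    · nlinarith [norm_nonneg (φ t)]
  have h5 := (setIntegral_eq_zero_iff_of_nonneg_ae ?_ (hi1.sub hi2)).1 h4
  · filter_upwards [(ae_restrict_iff' hA).1 h5] with t ht
    by_contra! htC
    have := ht htC
    simp only [Pi.zero_apply, Pi.sub_apply] at this
    nlinarith [norm_nonneg (φ t)]
  · refine (ae_restrict_iff' hA).2 (.of_forall fun t (ht : C < ‖φ t‖) => ?_)
    simp only [Pi.zero_apply, Pi.sub_apply]
    nlinarith [norm_nonneg (φ t)]

theorem monomial_eq_toLp (n : Fin 2 → ℤ) (v : E) :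
    monomial n v = ContinuousMap.toLp 2 haarT ℂ
      (⟨fun t => UnitAddTorus.mFourier n t • v, by fun_prop⟩ : C(Torus, E)) := by
  refine Lp.ext ?_
  rw [monomial_apply]
  filter_upwards [coeFn_contMul (UnitAddTorus.mFourier n) (constL2 v), coeFn_constL2 v,
    ContinuousMap.coeFn_toLp (p := 2) (𝕜 := ℂ) haarT
      (⟨fun t => UnitAddTorus.mFourier n t • v, by fun_prop⟩ : C(Torus, E))] with t h1 h2 h3
  rw [h1, h2, h3]
  rfl

variable [CompleteSpace E] {S : AddSubmonoid (Fin 2 → ℤ)}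

/-- The projector onto the functions with spectrum outside `S`. -/
abbrev coProj (S : AddSubmonoid (Fin 2 → ℤ)) : L2 E →L[ℂ] L2 E :=
  (spectralSubspace E (S : Set (Fin 2 → ℤ)))ᗮ.starProjection

/-- The bound on polynomials extends to their uniform limits. -/
theorem hankel_bound_contAlg {G : L2 E} {C : ℝ}
    (hG : ∀ h ∈ trigPoly S, ‖coProj S (contMul h G)‖ ≤ C * ‖ContinuousMap.toLp 2 haarT ℂ h‖)
    (h : C(Torus, ℂ)) (hh : h ∈ contAlg S) :
    ‖coProj S (contMul h G)‖ ≤ C * ‖ContinuousMap.toLp 2 haarT ℂ h‖ := by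
  have h1 : Continuous fun h : C(Torus, ℂ) => ‖coProj S (contMul h G)‖ := by
    have h3 : Continuous fun h : C(Torus, ℂ) => contMul h G := (contMul.flip G).continuous
    fun_prop
  have h2 : Continuous fun h : C(Torus, ℂ) => C * ‖ContinuousMap.toLp 2 haarT ℂ h‖ := by
    fun_prop
  exact contAlg_induction (isClosed_le h1 h2) hG hh

/-- If the Hankel operator with symbol `G` has norm at most `C` then `G` defines a functional with
`L¹` bound `C` on the continuous functions with spectrum outside `S`. -/
theorem norm_inner_le_of_hankel_bound (hS : ∀ n, n ∈ S ∨ -n ∈ S) {G : L2 E} {C : ℝ} (hC : 0 ≤ C)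
    (hG : ∀ h ∈ trigPoly S, ‖coProj S (contMul h G)‖ ≤ C * ‖ContinuousMap.toLp 2 haarT ℂ h‖)
    {g : C(Torus, E)}
    (hg : ContinuousMap.toLp 2 haarT ℂ g ∈ (spectralSubspace E (S : Set (Fin 2 → ℤ)))ᗮ) :
    ‖⟪G, ContinuousMap.toLp 2 haarT ℂ g⟫_ℂ‖ ≤ C * ∫ t, ‖g t‖ ∂haarT := by
  have hG' := hankel_bound_contAlg hG
  have hgi : Integrable (fun t => ‖g t‖) haarT :=
    (map_continuous g).norm.integrable_of_hasCompactSupport (HasCompactSupport.of_compactSpace _)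
  have hbound : ∀ ε > 0, ‖⟪G, ContinuousMap.toLp 2 haarT ℂ g⟫_ℂ‖ ≤
      C * (Real.exp ε * (∫ t, ‖g t‖ ∂haarT + ε)) := by
    intro ε hε
    have hpos : ∀ t, 0 < ‖g t‖ + ε := fun t => by positivity
    obtain ⟨r, hr, hru⟩ := exists_re_trigPoly_near hS (u := fun t => Real.log (‖g t‖ + ε))
      (by
        refine Continuous.log (by fun_prop) fun t => (hpos t).ne') hε
    -- `|exp (r / 2)| ^ 2` is comparable to `‖g‖ + ε`, and `exp (r / 2)` is invertible in `contAlg S`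
    set a := NormedSpace.exp ((2⁻¹ : ℂ) • r) with ha
    set b := NormedSpace.exp (-((2⁻¹ : ℂ) • r)) with hb
    have hra := Subalgebra.smul_mem _ (trigPoly_le_contAlg hr) (2⁻¹ : ℂ)
    have haS : a ∈ contAlg S := exp_mem_contAlg hra
    have hbS : b ∈ contAlg S := exp_mem_contAlg (neg_mem hra)
    have hna : ∀ t, ‖a t‖ ^ 2 = Real.exp (r t).re := fun t => by
      rw [ha, exp_continuousMap_apply, Complex.norm_exp, ← Real.exp_nat_mul]
      simp
    have hnb : ∀ t, ‖b t‖ ^ 2 = Real.exp (-(r t).re) := fun t => by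
      rw [hb, exp_continuousMap_apply, Complex.norm_exp, ← Real.exp_nat_mul]
      simp
    have hab : a * b = 1 := by
      ext t
      rw [ContinuousMap.mul_apply, ha, hb, exp_continuousMap_apply, exp_continuousMap_apply,
        ← Complex.exp_add]
      simp
    have hst : star a * star b = 1 := by
      ext t
      simpa [ContinuousMap.star_apply] using congrArg conj (ContinuousMap.congr_fun hab t)
    set F := ContinuousMap.toLp 2 haarT ℂ g with hF
    have hFg : F =ᵐ[haarT] g := ContinuousMap.coeFn_toLp haarT g
    have h1 : ⟪G, F⟫_ℂ = ⟪coProj S (contMul a G), contMul (star b) F⟫_ℂ := by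
      have h2 : contMul (star b) F ∈ (spectralSubspace E (S : Set (Fin 2 → ℤ)))ᗮ :=
        contMul_star_mem_orthogonal hbS hg
      rw [Submodule.inner_starProjection_left_eq_right,
        Submodule.starProjection_eq_self_iff.2 h2, inner_contMul_left, ← contMul_mul,
        hst, contMul_one]
    have hI : 0 ≤ Real.exp ε * (∫ t, ‖g t‖ ∂haarT + ε) := by
      have : 0 ≤ ∫ t, ‖g t‖ ∂haarT := integral_nonneg fun t => norm_nonneg _
      positivity
    have h3 : ‖ContinuousMap.toLp 2 haarT ℂ a‖ ^ 2 ≤ Real.exp ε * (∫ t, ‖g t‖ ∂haarT + ε) := by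
      have h4 : ∫ t, (‖g t‖ + ε) ∂haarT = ∫ t, ‖g t‖ ∂haarT + ε := by
        rw [integral_add hgi (integrable_const _)]; simp
      rw [norm_sq_eq_integral, ← h4, ← integral_const_mul]
      refine integral_mono_ae (integrable_norm_sq _)
        ((hgi.add (integrable_const ε)).const_mul _) ?_
      filter_upwards [ContinuousMap.coeFn_toLp (p := 2) (𝕜 := ℂ) haarT a] with t ht
      have h5 := abs_lt.1 (hru t)
      change _ ≤ Real.exp ε * (‖g t‖ + ε)
      rw [ht, hna, ← Real.exp_log (hpos t), ← Real.exp_add, Real.exp_le_exp]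
      linarith [h5.2]
    have h6 : ‖contMul (star b) F‖ ^ 2 ≤ Real.exp ε * (∫ t, ‖g t‖ ∂haarT + ε) := by
      have h4 : Real.exp ε * ∫ t, ‖g t‖ ∂haarT ≤ Real.exp ε * (∫ t, ‖g t‖ ∂haarT + ε) := by
        gcongr; linarith
      refine le_trans ?_ h4
      rw [norm_sq_eq_integral, ← integral_const_mul]
      refine integral_mono_ae (integrable_norm_sq _) (hgi.const_mul _) ?_
      filter_upwards [coeFn_contMul (star b) F, hFg] with t ht ht'
      have h5 := abs_lt.1 (hru t)
      change _ ≤ Real.exp ε * ‖g t‖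
      rw [ht, ht', norm_smul, mul_pow, ContinuousMap.star_apply, norm_star, hnb]
      have h7 : Real.exp (-(r t).re) * (‖g t‖ + ε) ≤ Real.exp ε := by
        nth_rewrite 1 [← Real.exp_log (hpos t)]
        rw [← Real.exp_add, Real.exp_le_exp]
        linarith [h5.1]
      have h8 : Real.exp (-(r t).re) * ‖g t‖ ≤ Real.exp ε := by
        refine le_trans ?_ h7
        gcongr
        linarith
      nlinarith [norm_nonneg (g t)]
    rw [h1]
    calc _ ≤ ‖coProj S (contMul a G)‖ * ‖contMul (star b) F‖ := norm_inner_le_norm _ _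
      _ ≤ (C * ‖ContinuousMap.toLp 2 haarT ℂ a‖) * ‖contMul (star b) F‖ := by
        gcongr; exact hG' a haS
      _ = C * (‖ContinuousMap.toLp 2 haarT ℂ a‖ * ‖contMul (star b) F‖) := mul_assoc _ _ _
      _ ≤ _ := mul_le_mul_of_nonneg_left (by
        nlinarith [sq_nonneg (‖ContinuousMap.toLp 2 haarT ℂ a‖ - ‖contMul (star b) F‖)]) hC
  have hlim : Filter.Tendsto (fun ε : ℝ => C * (Real.exp ε * (∫ t, ‖g t‖ ∂haarT + ε)))
      (nhdsWithin 0 (Set.Ioi 0)) (nhds (C * (Real.exp 0 * (∫ t, ‖g t‖ ∂haarT + 0)))) :=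
    (Continuous.tendsto (by fun_prop) 0).mono_left nhdsWithin_le_nhds
  rw [Real.exp_zero, one_mul, add_zero] at hlim
  exact ge_of_tendsto hlim (eventually_nhdsWithin_of_forall hbound)

/-- A form of Nehari's theorem with Hilbert-space valued symbols: a Hankel operator with respect to
a half-space `S` of frequencies has a bounded symbol with the same norm bound. -/
theorem exists_bounded_symbol (hS : ∀ n, n ∈ S ∨ -n ∈ S) {G : L2 E} {C : ℝ} (hC : 0 ≤ C)
    (hG : ∀ h ∈ trigPoly S, ‖coProj S (contMul h G)‖ ≤ C * ‖ContinuousMap.toLp 2 haarT ℂ h‖) :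
    ∃ φ : Linfty E, ‖φ‖ ≤ C ∧ coProj S (toL2 φ) = coProj S G := by
  let W : Submodule ℂ (L2 E) := (spectralSubspace E (S : Set (Fin 2 → ℤ)))ᗮ ⊓
    LinearMap.range (ContinuousMap.toLp 2 haarT ℂ : C(Torus, E) →L[ℂ] L2 E).toLinearMap
  let p : Seminorm ℂ (L2 E) := C.toNNReal • (normSeminorm ℂ _).comp (toL1 E).toLinearMap
  have hp : ∀ x, p x = C * ∫ t, ‖x t‖ ∂haarT := fun x => by
    rw [← norm_toL1]
    exact congrArg (· * ‖toL1 E x‖) (Real.coe_toNNReal C hC)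
  have hpc : Continuous p := by
    have : Continuous fun x : L2 E => C * ‖toL1 E x‖ := by fun_prop
    refine this.congr fun x => ?_
    rw [hp, norm_toL1]
  obtain ⟨Λ, hΛ, hΛp⟩ := Module.Dual.exists_continuous_extension_of_le_seminorm W
    ((innerSL ℂ G).toLinearMap ∘ₗ W.subtype) hpc (by
      rintro ⟨x, hx, g, rfl⟩
      rw [hp]
      refine (norm_inner_le_of_hankel_bound hS hC hG hx).trans_eq ?_
      congr 1
      refine integral_congr_ae ?_
      filter_upwards [ContinuousMap.coeFn_toLp (p := 2) (𝕜 := ℂ) haarT g] with t ht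
      exact congrArg norm ht.symm)
  let ψ : L2 E := (InnerProductSpace.toDual ℂ (L2 E)).symm Λ
  have hψ : ∀ x, ⟪ψ, x⟫_ℂ = Λ x := fun x => InnerProductSpace.toDual_symm_apply
  obtain ⟨φ, hφ, hφψ⟩ := exists_toL2_eq hC (ae_norm_le_of_inner_le hC fun x => by
    rw [hψ, ← hp]; exact hΛp x)
  refine ⟨φ, hφ, ?_⟩
  rw [← sub_eq_zero, ← map_sub, Submodule.starProjection_apply_eq_zero_iff,
    Submodule.orthogonal_orthogonal, hφψ]
  intro n hn
  refine ext_inner_left ℂ fun v => ?_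
  rw [← inner_monomial, inner_zero_right, ← inner_conj_symm, inner_sub_left, hψ]
  have hW : monomial n v ∈ W := by
    refine ⟨mem_orthogonal_spectralSubspace.2 fun m hm => ?_, _, (monomial_eq_toLp n v).symm⟩
    rw [mFourierCoeff_monomial, if_neg]
    rintro rfl
    exact hn hm
  have h1 := hΛ ⟨_, hW⟩
  simp only at h1
  rw [h1]
  simp

end Nehari

/-! ### Blaschke factors and model spaces -/

section Blaschke

/-- The frequencies `n` with `0 ≤ n k`. -/
def halfPlane (k : Fin 2) : AddSubmonoid (Fin 2 → ℤ) where
  carrier := {n | 0 ≤ n k}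
  zero_mem' := le_refl (0 : ℤ)
  add_mem' := fun {a b} ha hb => show 0 ≤ a k + b k from add_nonneg ha hb

/-- The frequencies with both coordinates nonnegative. -/
def quadrant : AddSubmonoid (Fin 2 → ℤ) where
  carrier := {n | ∀ k, 0 ≤ n k}
  zero_mem' := fun _ => le_refl (0 : ℤ)
  add_mem' := fun ha hb k => add_nonneg (ha k) (hb k)

theorem mem_halfPlane {k : Fin 2} {n : Fin 2 → ℤ} : n ∈ halfPlane k ↔ 0 ≤ n k := Iff.rfl

theorem mem_quadrant {n : Fin 2 → ℤ} : n ∈ quadrant ↔ ∀ k, 0 ≤ n k := Iff.rfl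

theorem norm_disc_lt_one (z : Disc) : ‖(z : ℂ)‖ < 1 := mem_ball_zero_iff.mp z.2

theorem norm_blaschke (z : Disc) (t : UnitAddCircle) : ‖blaschke z (fourier 1 t)‖ = 1 := by
  set w : ℂ := fourier 1 t with hw
  have hw1 : ‖w‖ = 1 := by rw [hw, fourier_apply, Circle.norm_coe]
  unfold blaschke
  split_ifs with hz
  · exact hw1
  · have h1 : ‖1 - w * conj (z : ℂ)‖ = ‖(z : ℂ) - w‖ := by
      have h2 : 1 - w * conj (z : ℂ) = w * conj (w - z) := by
        rw [map_sub, mul_sub, Complex.mul_conj, Complex.normSq_eq_norm_sq, hw1]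
        simp
      rw [h2, norm_mul, hw1, one_mul, RCLike.norm_conj, norm_sub_rev]
    have h3 : ‖(z : ℂ) - w‖ ≠ 0 := by
      rw [norm_ne_zero_iff, sub_ne_zero]
      intro h
      have := norm_disc_lt_one z
      rw [h, hw1] at this
      exact lt_irrefl _ this
    rw [norm_mul, norm_div, norm_div, h1, div_self h3, mul_one, Complex.norm_real, norm_norm,
      div_self (norm_ne_zero_iff.2 hz)]

theorem norm_blaschkeTensor (p : Disc × Disc) (t : Torus) : ‖blaschkeTensor p t‖ = 1 := by
  change ‖blaschke p.1 (fourier 1 (t 0)) * blaschke p.2 (fourier 1 (t 1))‖ = 1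
  rw [norm_mul, norm_blaschke, norm_blaschke, one_mul]

theorem single_mem_quadrant (k : Fin 2) : (Pi.single k 1 : Fin 2 → ℤ) ∈ quadrant := by
  intro j
  by_cases h : j = k
  · subst h; simp
  · simp [h]

/-- Blaschke factors in one of the variables are uniform limits of analytic polynomials, by the
geometric series. -/
theorem blaschke_mem_contAlg (z : Disc) (k : Fin 2) :
    (⟨fun t => blaschke z (fourier 1 (t k)),
      (continuous_blaschke z).comp (continuous_apply k)⟩ : C(Torus, ℂ)) ∈ contAlg quadrant := by
  set e : C(Torus, ℂ) := UnitAddTorus.mFourier (Pi.single k 1) with he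
  have het : ∀ t, e t = fourier 1 (t k) := fun t => UnitAddTorus.mFourier_single t k
  have heA : e ∈ contAlg quadrant :=
    trigPoly_le_contAlg (mFourier_mem_trigPoly (single_mem_quadrant k))
  by_cases hz : (z : ℂ) = 0
  · convert heA using 1
    ext t
    simp [blaschke, hz, het]
  · set x : C(Torus, ℂ) := conj (z : ℂ) • e with hx
    have hxn : ‖x‖ < 1 := by
      rw [hx, norm_smul, UnitAddTorus.mFourier_norm, mul_one, RCLike.norm_conj]
      exact norm_disc_lt_one z
    have hxA : x ∈ contAlg quadrant := Subalgebra.smul_mem _ heA _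
    have hs : ∑' i : ℕ, x ^ i ∈ contAlg quadrant :=
      tsum_mem isClosed_contAlg fun i => pow_mem hxA i
    have hmem : ((‖(z : ℂ)‖ : ℂ) / z) • (((z : ℂ) • (1 : C(Torus, ℂ)) - e) * ∑' i : ℕ, x ^ i) ∈
        contAlg quadrant :=
      Subalgebra.smul_mem _ (mul_mem (sub_mem (Subalgebra.smul_mem _ (one_mem _) _) heA) hs) _
    convert hmem using 1
    ext t
    have h1 := ContinuousMap.congr_fun (mul_neg_geom_series x hxn) t
    rw [ContinuousMap.mul_apply, ContinuousMap.sub_apply, ContinuousMap.one_apply, hx,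
      ContinuousMap.smul_apply, smul_eq_mul, ← hx, het, mul_comm (conj (z : ℂ))] at h1
    have h2 : (∑' i : ℕ, x ^ i : C(Torus, ℂ)) t =
        (1 - fourier 1 (t k) * conj (z : ℂ))⁻¹ := eq_inv_of_mul_eq_one_right h1
    simp only [ContinuousMap.coe_mk, blaschke, if_neg hz, ContinuousMap.smul_apply,
      ContinuousMap.mul_apply, ContinuousMap.sub_apply, ContinuousMap.one_apply, smul_eq_mul,
      mul_one, h2, het, div_eq_mul_inv]

theorem blaschkeTensor_mem_contAlg (p : Disc × Disc) : blaschkeTensor p ∈ contAlg quadrant :=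
  mul_mem (blaschke_mem_contAlg p.1 0) (blaschke_mem_contAlg p.2 1)

theorem mulOp_toLp (h : C(Torus, ℂ)) (f : L2 ℂ) :
    mulOp (h.toLp ∞ haarT ℂ) f = contMul h f := by
  refine Lp.ext ?_
  have h1 := (ContinuousLinearMap.mul ℂ ℂ).coeFn_holder (r := 2) (h.toLp ∞ haarT ℂ) f
  refine Filter.EventuallyEq.trans h1 ?_
  filter_upwards [ContinuousMap.coeFn_toLp (p := ∞) (𝕜 := ℂ) haarT h, coeFn_contMul h f]
    with t h2 h3
  rw [h2, h3, ContinuousLinearMap.mul_apply', smul_eq_mul]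

theorem coe_hankel (p : Disc × Disc) (f : hardy ℂ) :
    (hankel (symbConj p) f : L2 ℂ) =
      coProj quadrant (contMul (star (blaschkeTensor p)) (f : L2 ℂ)) := by
  rw [← mulOp_toLp]
  rfl

/-- The vectors `P_{zζ} f` and `Γ_{b̄_z ⊗ b̄_ζ} f` have the same norm: as `b = b_z ⊗ b_ζ` is inner,
`P_{zζ} f = f - b P (b̄ f) = b (I - P) (b̄ f)`. -/
theorem norm_projModel (p : Disc × Disc) (f : hardy ℂ) :
    ‖projModel p f‖ = ‖(hankel (symbConj p) f : L2 ℂ)‖ := by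
  set b := blaschkeTensor p with hb
  have hbb : b * star b = 1 := by
    ext t
    rw [ContinuousMap.mul_apply, ContinuousMap.star_apply, RCLike.star_def, Complex.mul_conj,
      Complex.normSq_eq_norm_sq, norm_blaschkeTensor]
    simp
  have hbb' : star b * b = 1 := by rw [mul_comm, hbb]
  set v := contMul b ((hardy ℂ).starProjection (contMul (star b) (f : L2 ℂ))) with hv
  have hPmem : (hardy ℂ).starProjection (contMul (star b) (f : L2 ℂ)) ∈ hardy ℂ :=
    Submodule.starProjection_apply_mem _ _
  have hvmem : v ∈ (hardy ℂ).map (mulOp (symb p)).toLinearMap :=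
    ⟨_, hPmem, mulOp_toLp _ _⟩
  have h1 : projModel p f = f - v := by
    refine Submodule.eq_starProjection_of_mem_of_inner_eq_zero ⟨?_, ?_⟩ fun w hw => ?_
    · exact sub_mem f.2
        (contMul_mem_spectralSubspace (S := quadrant) (blaschkeTensor_mem_contAlg p) hPmem)
    · rintro _ ⟨w, hw, rfl⟩
      have h2 : (mulOp (symb p)).toLinearMap w = contMul b w := mulOp_toLp _ _
      rw [h2, inner_contMul_left, map_sub, hv, ← contMul_mul, hbb', contMul_one]
      exact Submodule.sub_starProjection_mem_orthogonal _ w hw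
    · rw [sub_sub_cancel]
      exact hw.2 v hvmem
  have h3 : ∀ t, ‖(star b) t‖ = 1 := fun t => by
    rw [ContinuousMap.star_apply, norm_star, norm_blaschkeTensor]
  rw [h1, ← norm_contMul_of_unimodular h3, map_sub, hv, ← contMul_mul, hbb', contMul_one,
    coe_hankel, coProj, Submodule.starProjection_orthogonal_val]
  rfl

open Classical in
theorem mFourierCoeff_coProj {E : Type*} [NormedAddCommGroup E] [InnerProductSpace ℂ E]
    [CompleteSpace E] (S : AddSubmonoid (Fin 2 → ℤ)) (G : L2 E) (n : Fin 2 → ℤ) :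
    UnitAddTorus.mFourierCoeff (coProj S G) n =
      if n ∈ S then 0 else UnitAddTorus.mFourierCoeff G n := by
  rw [coProj, Submodule.starProjection_orthogonal_val, mFourierCoeff_sub,
    mFourierCoeff_starProjection]
  by_cases hn : n ∈ S <;> simp [hn]

theorem measurable_blaschkeTensor :
    Measurable fun x : (Disc × Disc) × Torus => blaschkeTensor x.1 x.2 := by
  have h : Measurable fun x : ℂ × ℂ => blaschke x.1 x.2 := by
    unfold blaschke
    refine Measurable.ite (measurableSet_eq_fun measurable_fst measurable_const) measurable_snd ?_
    fun_prop
  have hf : Measurable (fourier 1 : UnitAddCircle → ℂ) := (map_continuous _).measurable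
  have h0 : Measurable fun x : (Disc × Disc) × Torus =>
      blaschke (x.1.1 : ℂ) (fourier 1 (x.2 0)) := by
    refine h.comp (f := fun x : (Disc × Disc) × Torus => ((x.1.1 : ℂ), (fourier 1 (x.2 0) : ℂ))) ?_
    fun_prop
  have h1 : Measurable fun x : (Disc × Disc) × Torus =>
      blaschke (x.1.2 : ℂ) (fourier 1 (x.2 1)) := by
    refine h.comp (f := fun x : (Disc × Disc) × Torus => ((x.1.2 : ℂ), (fourier 1 (x.2 1) : ℂ))) ?_
    fun_prop
  exact h0.mul h1

/-- The Fourier coefficients of `Γ_{b̄_z ⊗ b̄_ζ} f` are measurable in `(z, ζ)`, being integrals of a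
jointly measurable function. -/
theorem measurable_hankelCoeff (f : hardy ℂ) (n : Fin 2 → ℤ) :
    Measurable fun p => UnitAddTorus.mFourierCoeff (hankel (symbConj p) f : L2 ℂ) n := by
  classical
  simp only [coe_hankel, mFourierCoeff_coProj]
  split_ifs
  · exact measurable_const
  · have h1 : ∀ p, UnitAddTorus.mFourierCoeff
        (contMul (star (blaschkeTensor p)) (f : L2 ℂ)) n =
        ∫ t, UnitAddTorus.mFourier (-n) t * (conj (blaschkeTensor p t) * (f : L2 ℂ) t) ∂haarT := by
      intro p
      refine integral_congr_ae ?_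
      filter_upwards [coeFn_contMul (star (blaschkeTensor p)) (f : L2 ℂ)] with t ht
      rw [ht]
      rfl
    simp only [h1]
    refine StronglyMeasurable.measurable (StronglyMeasurable.integral_prod_right
      (f := fun p t => UnitAddTorus.mFourier (-n) t *
        (conj (blaschkeTensor p t) * (f : L2 ℂ) t)) ?_)
    have h2 := (Lp.stronglyMeasurable (f : L2 ℂ)).measurable
    have h3 := measurable_blaschkeTensor
    have h4 : Measurable fun t : Torus => UnitAddTorus.mFourier (-n) t :=
      (map_continuous _).measurable
    refine Measurable.stronglyMeasurable ?_
    simp only [Function.uncurry_def]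
    exact (h4.comp measurable_snd).mul
      ((Complex.continuous_conj.measurable.comp h3).mul (h2.comp measurable_snd))

end Blaschke

/-! ### The values of the vector-valued Hankel operator -/

section HankelValue

theorem enorm_projModel_sq (p : Disc × Disc) (f : hardy ℂ) : ‖projModel p f‖ₑ ^ 2 =
    ∑' n, ‖UnitAddTorus.mFourierCoeff (hankel (symbConj p) f : L2 ℂ) n‖ₑ ^ 2 := by
  rw [← enorm_sq_eq_tsum, ← ofReal_norm, norm_projModel, ofReal_norm]

theorem measurable_enorm_projModel_sq (f : hardy ℂ) :
    Measurable fun p => ‖projModel p f‖ₑ ^ 2 := by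
  simp only [enorm_projModel_sq]
  exact Measurable.tsum fun n => (measurable_hankelCoeff f n).enorm.pow_const 2

variable {μ : Measure (Disc × Disc)}

theorem lintegral_projModel_eq_tsum (f : hardy ℂ) :
    ∫⁻ p, ‖projModel p f‖ₑ ^ 2 ∂(nu μ) = ∑' n, ∫⁻ p,
      ‖UnitAddTorus.mFourierCoeff (hankel (symbConj p) f : L2 ℂ) n‖ₑ ^ 2 ∂(nu μ) := by
  simp only [enorm_projModel_sq]
  exact lintegral_tsum fun n => ((measurable_hankelCoeff f n).enorm.pow_const 2).aemeasurable

theorem enorm_sq_L2nu (g : L2nu μ) : ‖g‖ₑ ^ 2 = ∫⁻ p, ‖g p‖ₑ ^ 2 ∂(nu μ) := by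
  rw [Lp.enorm_def]
  have := eLpNorm_nnreal_pow_eq_lintegral (p := 2) (μ := nu μ) (f := g) (by norm_num)
  norm_num at this
  exact this

/-- The fundamental identity: exchanging the variables turns the norm of `Γ⃗ f` into the
Carleson–Nikolskii integral. -/
theorem IsHankelValue.lintegral_eq {f : hardy ℂ} {G : L2 (L2nu μ)} (h : IsHankelValue μ f G) :
    ∫⁻ p, ‖projModel p f‖ₑ ^ 2 ∂(nu μ) = ‖G‖ₑ ^ 2 := by
  rw [lintegral_projModel_eq_tsum, enorm_sq_eq_tsum]
  refine tsum_congr fun n => ?_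
  rw [enorm_sq_L2nu]
  refine lintegral_congr_ae ?_
  filter_upwards [h n] with p hp
  rw [hp]

/-- Finiteness of the integral makes the Fourier coefficients of `Γ⃗ f` square-summable in
`L²(𝔻², ν)`; no σ-finiteness of `ν` is needed. -/
theorem exists_isHankelValue {f : hardy ℂ} (h : ∫⁻ p, ‖projModel p f‖ₑ ^ 2 ∂(nu μ) ≠ ∞) :
    ∃ G : L2 (L2nu μ), IsHankelValue μ f G := by
  rw [lintegral_projModel_eq_tsum] at h
  have hm : ∀ n, MemLp
      (fun p => UnitAddTorus.mFourierCoeff (hankel (symbConj p) f : L2 ℂ) n) 2 (nu μ) := by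
    intro n
    refine ⟨(measurable_hankelCoeff f n).aestronglyMeasurable, ?_⟩
    have h1 := ENNReal.ne_top_of_tsum_ne_top h n
    have h2 := eLpNorm_nnreal_pow_eq_lintegral (p := 2) (μ := nu μ)
      (f := fun p => UnitAddTorus.mFourierCoeff (hankel (symbConj p) f : L2 ℂ) n) (by norm_num)
    rw [lt_top_iff_ne_top]
    intro h3
    refine h1 ?_
    have h4 := h2.symm
    norm_num at h4
    rw [h4, h3]
    simp
  obtain ⟨G, hG⟩ := exists_mFourierCoeff_eq (fun n => (hm n).toLp _) (by
    refine ne_of_eq_of_ne (tsum_congr fun n => ?_) h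
    rw [enorm_sq_L2nu]
    refine lintegral_congr_ae ?_
    filter_upwards [(hm n).coeFn_toLp] with p hp
    rw [hp])
  refine ⟨G, fun n => ?_⟩
  rw [hG]
  exact (hm n).coeFn_toLp

theorem IsHankelValue.unique {f : hardy ℂ} {F G : L2 (L2nu μ)} (hF : IsHankelValue μ f F)
    (hG : IsHankelValue μ f G) : F = G :=
  ext_mFourierCoeff fun n => Lp.ext ((hF n).trans (hG n).symm)

theorem IsHankelValue.add {f g : hardy ℂ} {F G : L2 (L2nu μ)} (hF : IsHankelValue μ f F)
    (hG : IsHankelValue μ g G) : IsHankelValue μ (f + g) (F + G) := by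
  intro n
  rw [mFourierCoeff_add]
  filter_upwards [hF n, hG n, Lp.coeFn_add (UnitAddTorus.mFourierCoeff F n : L2nu μ)
    (UnitAddTorus.mFourierCoeff G n : L2nu μ)] with p h1 h2 h3
  rw [h3, Pi.add_apply, h1, h2, map_add, Submodule.coe_add, mFourierCoeff_add]

theorem IsHankelValue.smul {f : hardy ℂ} {F : L2 (L2nu μ)} (c : ℂ) (hF : IsHankelValue μ f F) :
    IsHankelValue μ (c • f) (c • F) := by
  intro n
  rw [mFourierCoeff_smul]
  filter_upwards [hF n, Lp.coeFn_smul c (UnitAddTorus.mFourierCoeff F n : L2nu μ)] with p h1 h3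
  rw [h3, Pi.smul_apply, h1, map_smul, Submodule.coe_smul, mFourierCoeff_smul]

theorem IsHankelValue.zero : IsHankelValue μ 0 0 := by
  intro n
  rw [mFourierCoeff_zero]
  filter_upwards [Lp.coeFn_zero ℂ 2 (nu μ)] with p hp
  rw [hp, map_zero, Submodule.coe_zero, mFourierCoeff_zero]
  rfl

theorem IsHankelValue.mem_orthogonal {f : hardy ℂ} {G : L2 (L2nu μ)} (h : IsHankelValue μ f G) :
    G ∈ (hardy (L2nu μ))ᗮ := by
  classical
  refine mem_orthogonal_spectralSubspace.2 fun n hn => Lp.ext ((h n).trans ?_)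
  filter_upwards [Lp.coeFn_zero ℂ 2 (nu μ)] with p hp
  rw [hp, coe_hankel, mFourierCoeff_coProj, if_pos (show n ∈ quadrant from hn)]
  rfl

/-- The projected product of a monomial with `Γ⃗ 1` is the value of `Γ⃗` at the monomial. -/
theorem isHankelValue_mFourier {G : L2 (L2nu μ)} (hG : IsHankelValue μ oneH2 G)
    {k : Fin 2 → ℤ} (hk : k ∈ quadrant) {f : hardy ℂ}
    (hf : (f : L2 ℂ) = UnitAddTorus.mFourierLp 2 k) :
    IsHankelValue μ f (coProj quadrant (contMul (UnitAddTorus.mFourier k) G)) := by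
  classical
  intro n
  rw [mFourierCoeff_coProj]
  split_ifs with hn
  · filter_upwards [Lp.coeFn_zero ℂ 2 (nu μ)] with p hp
    rw [hp, coe_hankel, mFourierCoeff_coProj, if_pos hn]
    rfl
  · have hnk : n - k ∉ quadrant := fun h => hn (by simpa using quadrant.add_mem h hk)
    rw [mFourierCoeff_contMul_mFourier]
    filter_upwards [hG (n - k)] with p hp
    rw [hp, coe_hankel, coe_hankel, mFourierCoeff_coProj, mFourierCoeff_coProj, if_neg hn,
      if_neg hnk, ← mFourierCoeff_contMul_mFourier, ← contMul_mul, mul_comm, contMul_mul]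
    congr 3
    rw [hf]
    congr 1
    refine Lp.ext ?_
    filter_upwards [coeFn_contMul (UnitAddTorus.mFourier k) ((oneH2 : hardy ℂ) : L2 ℂ),
      UnitAddTorus.coeFn_mFourierLp 2 k,
      UnitAddTorus.coeFn_mFourierLp (d := Fin 2) 2 0] with t h1 h2 h3
    rw [h1, h2]
    change _ • UnitAddTorus.mFourierLp (d := Fin 2) 2 0 t = _
    rw [h3, UnitAddTorus.mFourier_zero]
    simp

end HankelValue

/-! ### Carleson–Nikolskii measures and bounded Hankel operators -/

section Operator

variable {μ : Measure (Disc × Disc)}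

theorem toLp_mem_hardy {h : C(Torus, ℂ)} (hh : h ∈ trigPoly quadrant) :
    ContinuousMap.toLp 2 haarT ℂ h ∈ hardy ℂ := by
  have h1 : ContinuousMap.toLp 2 haarT ℂ h = contMul h (constL2 (1 : ℂ)) := by
    refine Lp.ext ?_
    filter_upwards [ContinuousMap.coeFn_toLp (p := 2) (𝕜 := ℂ) haarT h,
      coeFn_contMul h (constL2 (1 : ℂ)), coeFn_constL2 (1 : ℂ)] with t h1 h2 h3
    rw [h1, h2, h3, smul_eq_mul, mul_one]
  rw [h1]
  refine contMul_mem_spectralSubspace (S := quadrant) (trigPoly_le_contAlg hh) fun n hn => ?_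
  rw [mFourierCoeff_const, if_neg]
  rintro rfl
  exact hn quadrant.zero_mem

/-- On analytic polynomials `h` the operator `Γ⃗` is the Hankel operator with symbol `Γ⃗ 1`. -/
theorem isHankelValue_trigPoly {G : L2 (L2nu μ)} (hG : IsHankelValue μ oneH2 G)
    {h : C(Torus, ℂ)} (hh : h ∈ trigPoly quadrant) {f : hardy ℂ}
    (hf : (f : L2 ℂ) = ContinuousMap.toLp 2 haarT ℂ h) :
    IsHankelValue μ f (coProj quadrant (contMul h G)) := by
  induction hh using Submodule.span_induction generalizing f with
  | zero =>
    have h1 : f = 0 := Subtype.ext (by rw [hf, map_zero, Submodule.coe_zero])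
    have h2 : coProj quadrant (contMul 0 G) = 0 := by
      rw [map_zero, zero_apply, map_zero]
    rw [h1, h2]
    exact IsHankelValue.zero
  | add x y hx hy ihx ihy =>
    have h1 : f = ⟨_, toLp_mem_hardy hx⟩ + ⟨_, toLp_mem_hardy hy⟩ :=
      Subtype.ext (by rw [hf, map_add, Submodule.coe_add])
    have h2 : coProj quadrant (contMul (x + y) G) =
        coProj quadrant (contMul x G) + coProj quadrant (contMul y G) := by
      rw [map_add, add_apply, map_add]
    rw [h1, h2]
    exact (ihx rfl).add (ihy rfl)
  | smul c x hx ihx =>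
    have h1 : f = c • ⟨_, toLp_mem_hardy hx⟩ :=
      Subtype.ext (by rw [hf, map_smul, Submodule.coe_smul])
    have h2 : coProj quadrant (contMul (c • x) G) = c • coProj quadrant (contMul x G) := by
      rw [map_smul, smul_apply, map_smul]
    rw [h1, h2]
    exact (ihx rfl).smul c
  | mem x hx =>
    obtain ⟨k, hk, rfl⟩ := hx
    exact isHankelValue_mFourier hG hk hf

theorem enorm_le_of_sq_le {a b : ℝ≥0∞} {C : ℝ≥0} (h : a ^ 2 ≤ (C : ℝ≥0∞) ^ 2 * b ^ 2) :
    a ≤ C * b := by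
  rw [← mul_pow] at h
  exact (ENNReal.pow_le_pow_left_iff two_ne_zero).1 h

theorem IsCarlesonNikolskii.norm_le {C : ℝ≥0} (hC : IsCarlesonNikolskii μ C) {f : hardy ℂ}
    {G : L2 (L2nu μ)} (hG : IsHankelValue μ f G) : ‖G‖ ≤ C * ‖(f : L2 ℂ)‖ := by
  have h1 := hC f f.2
  rw [hG.lintegral_eq] at h1
  have h2 := enorm_le_of_sq_le h1
  rw [enorm_eq_nnnorm, enorm_eq_nnnorm] at h2
  exact_mod_cast h2

theorem IsCarlesonNikolskii.exists_isHankelValue {C : ℝ≥0} (hC : IsCarlesonNikolskii μ C)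
    (f : hardy ℂ) : ∃ G : L2 (L2nu μ), IsHankelValue μ f G := by
  refine CarlesonNikolskii.exists_isHankelValue (ne_top_of_le_ne_top ?_ (hC f f.2))
  finiteness

theorem IsCarlesonNikolskii.exists_isAssociatedHankel {C : ℝ≥0} (hC : IsCarlesonNikolskii μ C) :
    ∃ T : hardy ℂ →L[ℂ] (hardy (L2nu μ))ᗮ, IsAssociatedHankel μ T ∧ ‖T‖₊ ≤ C := by
  choose F hF using hC.exists_isHankelValue
  let T : hardy ℂ →ₗ[ℂ] (hardy (L2nu μ))ᗮ :=
    { toFun := fun f => ⟨F f, (hF f).mem_orthogonal⟩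
      map_add' := fun f g => Subtype.ext ((hF (f + g)).unique ((hF f).add (hF g)))
      map_smul' := fun c f => Subtype.ext ((hF (c • f)).unique ((hF f).smul c)) }
  refine ⟨T.mkContinuous C fun f => hC.norm_le (hF f), hF, ?_⟩
  exact T.mkContinuous_norm_le C.2 _

theorem IsAssociatedHankel.isCarlesonNikolskii {T : hardy ℂ →L[ℂ] (hardy (L2nu μ))ᗮ}
    (hT : IsAssociatedHankel μ T) {C : ℝ≥0} (hC : ‖T‖₊ ≤ C) : IsCarlesonNikolskii μ C := by
  intro f hf
  rw [(hT ⟨f, hf⟩).lintegral_eq, ← mul_pow]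
  gcongr
  have h1 : ‖T ⟨f, hf⟩‖₊ ≤ C * ‖f‖₊ := (T.le_opNNNorm ⟨f, hf⟩).trans (by gcongr; rfl)
  rw [enorm_eq_nnnorm, enorm_eq_nnnorm]
  exact_mod_cast h1

theorem IsAssociatedHankel.unique {T T' : hardy ℂ →L[ℂ] (hardy (L2nu μ))ᗮ}
    (hT : IsAssociatedHankel μ T) (hT' : IsAssociatedHankel μ T') : T = T' :=
  ContinuousLinearMap.ext fun f => Subtype.ext ((hT f).unique (hT' f))

theorem isLeast_isCarlesonNikolskii_iff {C : ℝ≥0} :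
    IsLeast {c : ℝ≥0 | IsCarlesonNikolskii μ c} C ↔
      ∃ T : hardy ℂ →L[ℂ] (hardy (L2nu μ))ᗮ, IsAssociatedHankel μ T ∧ ‖T‖₊ = C := by
  constructor
  · rintro ⟨h1, h2⟩
    obtain ⟨T, hT, hTC⟩ := IsCarlesonNikolskii.exists_isAssociatedHankel h1
    exact ⟨T, hT, le_antisymm hTC (h2 (hT.isCarlesonNikolskii le_rfl))⟩
  · rintro ⟨T, hT, rfl⟩
    refine ⟨hT.isCarlesonNikolskii le_rfl, fun c hc => ?_⟩
    obtain ⟨T', hT', hTc⟩ := IsCarlesonNikolskii.exists_isAssociatedHankel hc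
    rwa [hT.unique hT']

end Operator

/-! ### Big Hankel operators and restricted BMO -/

section BMO

variable {E : Type*} [NormedAddCommGroup E] [InnerProductSpace ℂ E]

theorem norm_contMul_toL2_le (h : C(Torus, ℂ)) (φ : Linfty E) :
    ‖contMul h (toL2 φ)‖ ≤ ‖φ‖ * ‖ContinuousMap.toLp 2 haarT ℂ h‖ := by
  refine Lp.norm_le_mul_norm_of_ae_le_mul ?_
  have h0 : ∀ᵐ t ∂haarT, ‖φ t‖ ≤ ‖φ‖ := by
    have := ae_le_eLpNormEssSup (f := φ) (μ := haarT)
    filter_upwards [this] with t ht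
    rw [← toReal_enorm (φ t), Lp.norm_def, eLpNorm_exponent_top]
    refine ENNReal.toReal_mono ?_ ht
    rw [← eLpNorm_exponent_top]
    exact Lp.eLpNorm_ne_top φ
  filter_upwards [h0, coeFn_contMul h (toL2 φ), coeFn_toL2 φ,
    ContinuousMap.coeFn_toLp (p := 2) (𝕜 := ℂ) haarT h] with t h1 h2 h3 h4
  rw [h2, h3, h4, norm_smul, mul_comm]
  gcongr

variable [CompleteSpace E]

theorem trigPoly_mono {S S' : AddSubmonoid (Fin 2 → ℤ)} (h : S ≤ S') : trigPoly S ≤ trigPoly S' :=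
  Submodule.span_mono (Set.image_mono h)

theorem quadrant_le_halfPlane (k : Fin 2) : quadrant ≤ halfPlane k := fun _ hn => hn k

theorem coProj_halfPlane (k : Fin 2) (G : L2 E) : coProj (halfPlane k) G = G - projVar E k G :=
  Submodule.starProjection_orthogonal_val _

theorem coProj_contMul_congr {S : AddSubmonoid (Fin 2 → ℤ)} {F G : L2 E}
    (hFG : coProj S F = coProj S G) {h : C(Torus, ℂ)} (hh : h ∈ trigPoly S) :
    coProj S (contMul h F) = coProj S (contMul h G) := by
  rw [← sub_eq_zero, ← map_sub, Submodule.starProjection_apply_eq_zero_iff,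
    Submodule.orthogonal_orthogonal] at hFG ⊢
  rw [← map_sub]
  exact contMul_mem_spectralSubspace (trigPoly_le_contAlg hh) hFG

/-- The splitting `I - P = (I - P_x) + P_x (I - P_y)`. -/
theorem coProj_quadrant (G : L2 E) : coProj quadrant G =
    coProj (halfPlane 0) G + projVar E 0 (coProj (halfPlane 1) G) := by
  classical
  refine ext_mFourierCoeff fun n => ?_
  have h := mFourierCoeff_starProjection {n : Fin 2 → ℤ | 0 ≤ n 0} (coProj (halfPlane 1) G) n
  rw [mFourierCoeff_add, projVar, h]
  simp only [mFourierCoeff_coProj, mem_quadrant, mem_halfPlane, Set.mem_ofPred_eq,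
    Fin.forall_fin_two]
  split_ifs <;> simp_all

/-- A symbol with a decomposition into bounded functions has a bounded Hankel operator. -/
theorem IsBMOrDecomposition.norm_coProj_le {G : L2 E} {φ₀ φ₁ φ₂ : Linfty E}
    (hG : IsBMOrDecomposition G φ₀ φ₁ φ₂) {h : C(Torus, ℂ)} (hh : h ∈ trigPoly quadrant) :
    ‖coProj quadrant (contMul h G)‖ ≤
      (‖φ₁‖ + ‖φ₂‖) * ‖ContinuousMap.toLp 2 haarT ℂ h‖ := by
  have key : ∀ (k : Fin 2) (φ : Linfty E), coProj (halfPlane k) G = coProj (halfPlane k) (toL2 φ) →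
      ‖coProj (halfPlane k) (contMul h G)‖ ≤ ‖φ‖ * ‖ContinuousMap.toLp 2 haarT ℂ h‖ := by
    intro k φ hφ
    rw [coProj_contMul_congr hφ (trigPoly_mono (quadrant_le_halfPlane k) hh)]
    exact (Submodule.norm_starProjection_apply_le _ _).trans (norm_contMul_toL2_le h φ)
  rw [coProj_quadrant, add_mul]
  refine (norm_add_le _ _).trans (add_le_add (key 0 φ₁ ?_) ?_)
  · rw [coProj_halfPlane, coProj_halfPlane, hG.first]
  · refine (Submodule.norm_starProjection_apply_le _ _).trans (key 1 φ₂ ?_)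
    rw [coProj_halfPlane, coProj_halfPlane, hG.second]

/-- Every polynomial with frequencies in a half-plane becomes analytic in both variables after
multiplication by a monomial in the other variable. -/
theorem exists_mFourier_mul_mem_trigPoly {k : Fin 2} {h : C(Torus, ℂ)}
    (hh : h ∈ trigPoly (halfPlane k)) :
    ∃ N : Fin 2 → ℤ, N k = 0 ∧ UnitAddTorus.mFourier N * h ∈ trigPoly quadrant := by
  let N : ℕ → Fin 2 → ℤ := fun m j => if j = k then 0 else m
  suffices h : ∃ m₀, ∀ m ≥ m₀, UnitAddTorus.mFourier (N m) * h ∈ trigPoly quadrant by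
    obtain ⟨m, hm⟩ := h
    exact ⟨N m, if_pos rfl, hm m le_rfl⟩
  induction hh using Submodule.span_induction with
  | zero => exact ⟨0, fun m _ => by rw [mul_zero]; exact zero_mem _⟩
  | add x y _ _ hx hy =>
    obtain ⟨a, ha⟩ := hx
    obtain ⟨b, hb⟩ := hy
    refine ⟨max a b, fun m hm => ?_⟩
    rw [mul_add]
    exact add_mem (ha m (le_of_max_le_left hm)) (hb m (le_of_max_le_right hm))
  | smul c x _ hx =>
    obtain ⟨a, ha⟩ := hx
    refine ⟨a, fun m hm => ?_⟩
    rw [mul_smul_comm]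
    exact Submodule.smul_mem _ c (ha m hm)
  | mem x hx =>
    obtain ⟨n, hn, rfl⟩ := hx
    have hn' : 0 ≤ n k := hn
    refine ⟨(n 0).natAbs + (n 1).natAbs, fun m hm => ?_⟩
    rw [mFourier_mul_mFourier]
    refine mFourier_mem_trigPoly fun j => ?_
    by_cases hj : j = k
    · subst hj
      simpa [N] using hn'
    · simp only [Pi.add_apply, N, if_neg hj]
      fin_cases j <;> simp only [Fin.zero_eta, Fin.mk_one] <;> omega

theorem coProj_halfPlane_contMul_mFourier {k : Fin 2} {N : Fin 2 → ℤ} (hN : N k = 0) (G : L2 E) :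
    coProj (halfPlane k) (contMul (UnitAddTorus.mFourier N) G) =
      contMul (UnitAddTorus.mFourier N) (coProj (halfPlane k) G) := by
  classical
  refine ext_mFourierCoeff fun n => ?_
  rw [mFourierCoeff_coProj, mFourierCoeff_contMul_mFourier, mFourierCoeff_contMul_mFourier,
    mFourierCoeff_coProj]
  simp [mem_halfPlane, hN]

theorem norm_coProj_halfPlane_le (k : Fin 2) (G : L2 E) :
    ‖coProj (halfPlane k) G‖ ≤ ‖coProj quadrant G‖ := by
  classical
  have h1 : coProj (halfPlane k) G = coProj (halfPlane k) (coProj quadrant G) := by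
    refine ext_mFourierCoeff fun n => ?_
    simp only [mFourierCoeff_coProj]
    by_cases hn : n ∈ quadrant
    · simp [quadrant_le_halfPlane k hn]
    · simp [hn]
  rw [h1]
  exact Submodule.norm_starProjection_apply_le _ _

/-- A bound for the big Hankel operator with symbol `G` bounds the Hankel operator in each of the
variables, as the latter commutes with the monomials in the other variable. -/
theorem norm_coProj_halfPlane_contMul_le {G : L2 E} {C : ℝ}
    (hG : ∀ h ∈ trigPoly quadrant,
      ‖coProj quadrant (contMul h G)‖ ≤ C * ‖ContinuousMap.toLp 2 haarT ℂ h‖)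
    (k : Fin 2) {h : C(Torus, ℂ)} (hh : h ∈ trigPoly (halfPlane k)) :
    ‖coProj (halfPlane k) (contMul h G)‖ ≤ C * ‖ContinuousMap.toLp 2 haarT ℂ h‖ := by
  obtain ⟨N, hN, hNh⟩ := exists_mFourier_mul_mem_trigPoly hh
  have h1 : ContinuousMap.toLp 2 haarT ℂ (UnitAddTorus.mFourier N * h) =
      contMul (UnitAddTorus.mFourier N) (ContinuousMap.toLp 2 haarT ℂ h) := by
    refine Lp.ext ?_
    filter_upwards [ContinuousMap.coeFn_toLp (p := 2) (𝕜 := ℂ) haarT (UnitAddTorus.mFourier N * h),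
      ContinuousMap.coeFn_toLp (p := 2) (𝕜 := ℂ) haarT h,
      coeFn_contMul (UnitAddTorus.mFourier N) (ContinuousMap.toLp 2 haarT ℂ h)] with t h1 h2 h3
    rw [h1, h3, h2, ContinuousMap.mul_apply, smul_eq_mul]
  calc ‖coProj (halfPlane k) (contMul h G)‖
      = ‖coProj (halfPlane k) (contMul (UnitAddTorus.mFourier N * h) G)‖ := by
        rw [contMul_mul, coProj_halfPlane_contMul_mFourier hN,
          norm_contMul_of_unimodular (norm_mFourier_apply N)]
    _ ≤ ‖coProj quadrant (contMul (UnitAddTorus.mFourier N * h) G)‖ :=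
        norm_coProj_halfPlane_le k _
    _ ≤ C * ‖ContinuousMap.toLp 2 haarT ℂ (UnitAddTorus.mFourier N * h)‖ := hG _ hNh
    _ = C * ‖ContinuousMap.toLp 2 haarT ℂ h‖ := by
        rw [h1, norm_contMul_of_unimodular (norm_mFourier_apply N)]

/-- The symbol in `H²(𝕋²; E)^⊥` of a bounded big Hankel operator is in restricted BMO. -/
theorem exists_isBMOrDecomposition {G : L2 E} (hGo : G ∈ (hardy E)ᗮ) {C : ℝ} (hC : 0 ≤ C)
    (hG : ∀ h ∈ trigPoly quadrant,
      ‖coProj quadrant (contMul h G)‖ ≤ C * ‖ContinuousMap.toLp 2 haarT ℂ h‖) :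
    ∃ φ₁ φ₂ : Linfty E, IsBMOrDecomposition G 0 φ₁ φ₂ ∧ ‖φ₁‖ ≤ C ∧ ‖φ₂‖ ≤ C := by
  classical
  have hS : ∀ (k : Fin 2) (n : Fin 2 → ℤ), n ∈ halfPlane k ∨ -n ∈ halfPlane k := fun k n => by
    simp only [mem_halfPlane, Pi.neg_apply]; omega
  have hφ := fun k => exists_bounded_symbol (hS k) hC
    fun h hh => norm_coProj_halfPlane_contMul_le hG k hh
  choose φ hφC hφ using hφ
  have hP : ∀ F : L2 E, F ∈ (hardy E)ᗮ → projVar E 0 (projVar E 1 F) = 0 := by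
    intro F hF
    refine ext_mFourierCoeff fun n => ?_
    rw [projVar, projVar, mFourierCoeff_starProjection, mFourierCoeff_starProjection,
      mFourierCoeff_zero]
    split_ifs with h0 h1
    · exact mem_orthogonal_spectralSubspace.1 hF n (Fin.forall_fin_two.2 ⟨h0, h1⟩)
    · rfl
    · rfl
  refine ⟨φ 0, φ 1, ⟨?_, ?_, ?_⟩, hφC 0, hφC 1⟩
  · rw [← coProj_halfPlane, ← coProj_halfPlane, hφ]
  · rw [← coProj_halfPlane, ← coProj_halfPlane, hφ]
  · have h0 : toL2 (0 : Linfty E) = 0 := by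
      refine Lp.ext ((coeFn_toL2 _).trans ?_)
      exact (Lp.coeFn_zero E ∞ haarT).trans (Lp.coeFn_zero E 2 haarT).symm
    rw [hP G hGo, h0, map_zero, map_zero]

end BMO

/-! ### Carleson–Nikolskii measures and restricted BMO -/

section Main

variable {μ : Measure (Disc × Disc)}

theorem IsCarlesonNikolskii.exists_isBMOrDecomposition {C : ℝ≥0} (hC : IsCarlesonNikolskii μ C)
    {G : L2 (L2nu μ)} (hG : IsHankelValue μ oneH2 G) :
    ∃ φ₁ φ₂ : Linfty (L2nu μ), IsBMOrDecomposition G 0 φ₁ φ₂ ∧ ‖φ₁‖ ≤ C ∧ ‖φ₂‖ ≤ C := by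
  have h1 : ∀ h ∈ trigPoly quadrant,
      ‖coProj quadrant (contMul h G)‖ ≤ (C : ℝ) * ‖ContinuousMap.toLp 2 haarT ℂ h‖ := by
    intro h hh
    obtain ⟨f, hf⟩ : ∃ f : hardy ℂ, (f : L2 ℂ) = ContinuousMap.toLp 2 haarT ℂ h :=
      ⟨⟨_, toLp_mem_hardy hh⟩, rfl⟩
    have h2 := hC.norm_le (isHankelValue_trigPoly hG hh hf)
    rw [hf] at h2
    exact h2
  exact CarlesonNikolskii.exists_isBMOrDecomposition hG.mem_orthogonal C.coe_nonneg h1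

/-- Analytic polynomials are dense in `H²(𝕋²)`. -/
theorem mem_closure_trigPoly {f : L2 ℂ} (hf : f ∈ hardy ℂ) :
    f ∈ closure (ContinuousMap.toLp 2 haarT ℂ '' (trigPoly quadrant : Set C(Torus, ℂ))) := by
  refine mem_closure_of_tendsto (UnitAddTorus.hasSum_mFourier_series_L2 f) (.of_forall fun s => ?_)
  refine ⟨∑ n ∈ s, UnitAddTorus.mFourierCoeff f n • UnitAddTorus.mFourier n,
    sum_mem fun n _ => ?_, ?_⟩
  · by_cases hn : n ∈ quadrant
    · exact Submodule.smul_mem _ _ (mFourier_mem_trigPoly hn)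
    · have h0 : UnitAddTorus.mFourierCoeff f n = 0 := hf n hn
      have h1 : UnitAddTorus.mFourierCoeff f n • UnitAddTorus.mFourier n = (0 : C(Torus, ℂ)) := by
        rw [h0]
        exact zero_smul ℂ (UnitAddTorus.mFourier n : C(Torus, ℂ))
      rw [h1]
      exact zero_mem _
  · rw [map_sum]
    refine Finset.sum_congr rfl fun n _ => ?_
    exact map_smul _ _ _

/-- It is enough to test the Carleson–Nikolskii inequality on analytic polynomials. -/
theorem isCarlesonNikolskii_of_trigPoly {C : ℝ≥0}
    (h : ∀ h ∈ trigPoly quadrant,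
      ∫⁻ p, ‖projModel p (ContinuousMap.toLp 2 haarT ℂ h)‖ₑ ^ 2 ∂(nu μ) ≤
        (C : ℝ≥0∞) ^ 2 * ‖ContinuousMap.toLp 2 haarT ℂ h‖ₑ ^ 2) : IsCarlesonNikolskii μ C := by
  intro f hf
  obtain ⟨x, hx, hxf⟩ := mem_closure_iff_seq_limit.1 (mem_closure_trigPoly hf)
  have hxm : ∀ j, x j ∈ hardy ℂ := fun j => by
    obtain ⟨g, hg, hgx⟩ := hx j
    rw [← hgx]
    exact toLp_mem_hardy hg
  have h1 : ∀ p, Filter.Tendsto (fun j => ‖projModel p (x j)‖ₑ ^ 2) Filter.atTop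
      (nhds (‖projModel p f‖ₑ ^ 2)) := fun p =>
    ((ENNReal.continuous_pow 2).comp (continuous_enorm.comp (projModel p).continuous)).tendsto f
      |>.comp hxf
  have h2 : Filter.Tendsto (fun j => (C : ℝ≥0∞) ^ 2 * ‖x j‖ₑ ^ 2) Filter.atTop
      (nhds ((C : ℝ≥0∞) ^ 2 * ‖f‖ₑ ^ 2)) := by
    refine ENNReal.Tendsto.const_mul ?_ (Or.inr (by finiteness))
    exact ((ENNReal.continuous_pow 2).comp continuous_enorm).tendsto f |>.comp hxf
  calc ∫⁻ p, ‖projModel p f‖ₑ ^ 2 ∂(nu μ)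
      = ∫⁻ p, Filter.liminf (fun j => ‖projModel p (x j)‖ₑ ^ 2) Filter.atTop ∂(nu μ) :=
        lintegral_congr fun p => (h1 p).liminf_eq.symm
    _ ≤ Filter.liminf (fun j => ∫⁻ p, ‖projModel p (x j)‖ₑ ^ 2 ∂(nu μ)) Filter.atTop :=
        lintegral_liminf_le fun j => measurable_enorm_projModel_sq ⟨x j, hxm j⟩
    _ ≤ Filter.liminf (fun j => (C : ℝ≥0∞) ^ 2 * ‖x j‖ₑ ^ 2) Filter.atTop := by
        refine Filter.liminf_le_liminf (.of_forall fun j => ?_)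
        obtain ⟨g, hg, hgx⟩ := hx j
        rw [← hgx]
        exact h g hg
    _ = (C : ℝ≥0∞) ^ 2 * ‖f‖ₑ ^ 2 := h2.liminf_eq

theorem IsBMOrDecomposition.isCarlesonNikolskii {G : L2 (L2nu μ)} {φ₀ φ₁ φ₂ : Linfty (L2nu μ)}
    (hG : IsBMOrDecomposition G φ₀ φ₁ φ₂) (hv : IsHankelValue μ oneH2 G) :
    IsCarlesonNikolskii μ (‖φ₁‖₊ + ‖φ₂‖₊) := by
  refine isCarlesonNikolskii_of_trigPoly fun h hh => ?_
  have h1 := (isHankelValue_trigPoly hv hh (f := ⟨_, toLp_mem_hardy hh⟩) rfl).lintegral_eq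
  simp only at h1
  rw [h1, ← mul_pow]
  gcongr
  have h2 : ‖coProj quadrant (contMul h G)‖₊ ≤
      (‖φ₁‖₊ + ‖φ₂‖₊) * ‖ContinuousMap.toLp 2 haarT ℂ h‖₊ := hG.norm_coProj_le hh
  rw [enorm_eq_nnnorm, enorm_eq_nnnorm]
  exact_mod_cast h2

theorem IsCarlesonNikolskii.bmorNorm_le {C : ℝ≥0} (hC : IsCarlesonNikolskii μ C)
    {G : L2 (L2nu μ)} (hG : IsHankelValue μ oneH2 G) : bmorNorm G ≤ C := by
  obtain ⟨φ₁, φ₂, hd, h1, h2⟩ := hC.exists_isBMOrDecomposition hG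
  refine (iInf₂_le_of_le 0 φ₁ (iInf₂_le_of_le φ₂ hd le_rfl)).trans (max_le ?_ (max_le ?_ ?_))
  · simp
  · rw [enorm_eq_nnnorm]; exact_mod_cast h1
  · rw [enorm_eq_nnnorm]; exact_mod_cast h2

/-- Every decomposition of `Γ⃗ 1` gives the Carleson–Nikolskii constant `‖φ₁‖ + ‖φ₂‖`, which is at
most twice the maximum of the norms. -/
theorem le_two_mul_bmorNorm {C : ℝ≥0} (hC : C ∈ lowerBounds {c : ℝ≥0 | IsCarlesonNikolskii μ c})
    {G : L2 (L2nu μ)} (hG : IsHankelValue μ oneH2 G) : (C : ℝ≥0∞) ≤ 2 * bmorNorm G := by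
  rw [← ENNReal.div_le_iff' two_ne_zero ENNReal.ofNat_ne_top]
  refine le_iInf₂ fun φ₀ φ₁ => le_iInf₂ fun φ₂ hd => ?_
  rw [ENNReal.div_le_iff' two_ne_zero ENNReal.ofNat_ne_top]
  have h1 : (C : ℝ≥0∞) ≤ ‖φ₁‖ₑ + ‖φ₂‖ₑ := by
    rw [enorm_eq_nnnorm, enorm_eq_nnnorm]
    exact_mod_cast hC (hd.isCarlesonNikolskii hG)
  refine h1.trans ?_
  rw [two_mul]
  exact add_le_add ((le_max_left _ _).trans (le_max_right _ _))
    ((le_max_right _ _).trans (le_max_right _ _))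

end Main

end CarlesonNikolskii
end

theorem theorem4p3 :
    ∃ K : ℝ≥0, ∀ μ : Measure (Disc × Disc),
      (∀ C : ℝ≥0, IsCarlesonNikolskii μ C ↔
        ∃ T : hardy ℂ →L[ℂ] (hardy (L2nu μ))ᗮ, IsAssociatedHankel μ T ∧ ‖T‖₊ ≤ C) ∧
      (∀ C : ℝ≥0, IsLeast {c : ℝ≥0 | IsCarlesonNikolskii μ c} C ↔
        ∃ T : hardy ℂ →L[ℂ] (hardy (L2nu μ))ᗮ, IsAssociatedHankel μ T ∧ ‖T‖₊ = C) ∧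
      ((∃ C : ℝ≥0, IsCarlesonNikolskii μ C) ↔
        ∃ G : L2 (L2nu μ), IsHankelValue μ oneH2 G ∧ MemBMOr G) ∧
      (∀ (C : ℝ≥0) (G : L2 (L2nu μ)), IsLeast {c : ℝ≥0 | IsCarlesonNikolskii μ c} C →
        IsHankelValue μ oneH2 G → bmorNorm G ≤ K * C ∧ C ≤ K * bmorNorm G) := by
  refine ⟨2, fun μ => ⟨fun C => ⟨fun h => h.exists_isAssociatedHankel,
    fun ⟨T, hT, hTC⟩ => hT.isCarlesonNikolskii hTC⟩, fun C => isLeast_isCarlesonNikolskii_iff,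
    ⟨?_, ?_⟩, fun C G hC hG => ⟨?_, ?_⟩⟩⟩
  · rintro ⟨C, hC⟩
    obtain ⟨G, hG⟩ := hC.exists_isHankelValue oneH2
    obtain ⟨φ₁, φ₂, hd, -⟩ := hC.exists_isBMOrDecomposition hG
    exact ⟨G, hG, 0, φ₁, φ₂, hd⟩
  · rintro ⟨G, hG, φ₀, φ₁, φ₂, hd⟩
    exact ⟨_, hd.isCarlesonNikolskii hG⟩
  · refine (IsCarlesonNikolskii.bmorNorm_le hC.1 hG).trans ?_
    exact le_mul_of_one_le_left zero_le (by norm_num)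
  · exact_mod_cast le_two_mul_bmorNorm hC.2 hG
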